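/- Let $H$ be a complex Hilbert space, $\Theta\subseteq\mathbb{C}^k$ open, and let $|\psi(\theta)\rangle\in H$, $\theta=\alpha+i\beta\in\Theta$, be unit vectors such that at $\theta_0\in\Theta$ all partial derivatives of $\psi$ with respect to $\alpha_j,\beta_j$ exist. Put $\rho(\theta)=|\psi(\theta)\rangle\langle\psi(\theta)|$, $\partial_{\theta_j}=\frac12(\partial_{\alpha_j}-i\partial_{\beta_j})$, $\partial_{\theta_j^*}=\frac12(\partial_{\alpha_j}+i\partial_{\beta_j})$ and $\hat\theta=(\theta_1,\dots,\theta_k,\theta_1^*,\dots,\theta_k^*)$. Let $\mathcal{L}_{\hat\theta_a}$, $a=1,\dots,2k$, be complex symmetric logarithmic derivatives at $\theta_0$, that is, bounded operators with $\partial_{\hat\theta_a}\rho=\frac12(\rho\,\mathcal{L}_{\hat\theta_a}+\mathcal{L}_{\hat\theta_a}\rho)$ at $\theta_0$. Let $$\mathcal{J}^S_{\hat\theta}=\begin{pmatrix}\mathtt{J}&\mathtt{Q}\\ \mathtt{Q}^*&\mathtt{J}^*\end{pmatrix},\quad \mathtt{J}_{ij}=\tfrac12\mathrm{Tr}\,\rho\big(\mathcal{L}_{\theta_i^*}\mathcal{L}_{\theta_j}+\mathcal{L}_{\theta_j}\mathcal{L}_{\theta_i^*}\big),\quad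 \mathtt{Q}_{ij}=\tfrac12\mathrm{Tr}\,\rho\big(\mathcal{L}_{\theta_i^*}\mathcal{L}_{\theta_j^*}+\mathcal{L}_{\theta_j^*}\mathcal{L}_{\theta_i^*}\big)$$ (${}^*$ on a matrix is the entrywise conjugate, everything is taken at $\theta_0$) be the symmetric quantum Fisher information matrix, and assume that it is invertible. For a generalized measurement (POVM) $M$ on a measurable space $\Omega$ and a measurable $t:\Omega\to\mathbb{C}^k$, let $g(\theta)=\mathbb{E}_\theta(t)$ be the expectation under the outcome law $B\mapsto\langle\psi(\theta)|M(B)|\psi(\theta)\rangle$, let $\hat t=(t,t^*)$ and $\mathrm{Cov}(\hat t)=\mathbb{E}_{\theta_0}\big((\hat t-\mathbb{E}_{\theta_0}\hat t)(\hat t-\mathbb{E}_{\theta_0}\hat t)^\dagger\big)$. Call $t$ a locally unbiased estimator at $\theta_0$ if each $\mathbb{E}_\theta|t_i|^2$ is bounded for $\theta$ in a neighbourhood of $\theta_0$, $g(\theta_0)=\theta_0$, the partial derivatives of $g$ with respect to $\alpha_j,\beta_j$ exist at $\theta_0$, and $\partial_{\theta_j}g_i(\theta_0)=\delta_{ij}$,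 $\partial_{\theta_j^*}g_i(\theta_0)=0$. Then the symmetric quantum Cramér-Rao bound is attainable at $\theta_0$, that is, there are a generalized measurement and a locally unbiased estimator $t$ at $\theta_0$ with $\mathrm{Cov}(\hat t)=(\mathcal{J}^S_{\hat\theta})^{-1}$, if and only if $$\langle\psi(\theta_0)|[\mathcal{L}_{\hat\theta_a},\mathcal{L}_{\hat\theta_b}]|\psi(\theta_0)\rangle=0\qquad\text{for all }a,b=1,\dots,2k.$$ -/

import Mathlib

open MeasureTheory Filter Topology
open scoped ComplexConjugate NNReal ENNReal InnerProductSpace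

noncomputable section

namespace ComplexQCRB

/-! ### Wirtinger calculus -/

section Wirtinger

variable {k : ℕ} {E : Type*} [NormedAddCommGroup E] [NormedSpace ℂ E]

/-- All partial derivatives of `F` with respect to the real parts `α j` and the imaginary parts
`β j` of the complex variables `θ j = α j + i β j` exist at `θ₀`. -/
def HasPartials (F : (Fin k → ℂ) → E) (θ₀ : Fin k → ℂ) : Prop :=
  ∀ j : Fin k, LineDifferentiableAt ℝ F θ₀ (Pi.single j 1) ∧
    LineDifferentiableAt ℝ F θ₀ (Pi.single j Complex.I)

/-- The Wirtinger derivative `∂F/∂θ_j = (∂F/∂α_j - i ∂F/∂β_j) / 2`. -/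
def dz (F : (Fin k → ℂ) → E) (θ₀ : Fin k → ℂ) (j : Fin k) : E :=
  (1 / 2 : ℂ) • (lineDeriv ℝ F θ₀ (Pi.single j 1) -
    Complex.I • lineDeriv ℝ F θ₀ (Pi.single j Complex.I))

/-- The Wirtinger derivative `∂F/∂θ_j^* = (∂F/∂α_j + i ∂F/∂β_j) / 2`. -/
def dzbar (F : (Fin k → ℂ) → E) (θ₀ : Fin k → ℂ) (j : Fin k) : E :=
  (1 / 2 : ℂ) • (lineDeriv ℝ F θ₀ (Pi.single j 1) +
    Complex.I • lineDeriv ℝ F θ₀ (Pi.single j Complex.I))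

/-- The derivative with respect to an entry of the conjugate extension `(θ, θ^*)`:
`inl j` stands for `θ_j`, `inr j` for `θ_j^*`. -/
def dhat (F : (Fin k → ℂ) → E) (θ₀ : Fin k → ℂ) : Fin k ⊕ Fin k → E :=
  Sum.elim (dz F θ₀) (dzbar F θ₀)

/-- The Wirtinger Jacobian matrix of the conjugate extension of `g`. -/
def jacobianHat (g : (Fin k → ℂ) → (Fin k → ℂ)) (θ₀ : Fin k → ℂ) :
    Matrix (Fin k ⊕ Fin k) (Fin k ⊕ Fin k) ℂ :=
  Matrix.fromBlocks
    (Matrix.of fun i j => dz (fun θ => g θ i) θ₀ j)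
    (Matrix.of fun i j => dzbar (fun θ => g θ i) θ₀ j)
    (Matrix.of fun i j => conj (dzbar (fun θ => g θ i) θ₀ j))
    (Matrix.of fun i j => conj (dz (fun θ => g θ i) θ₀ j))

end Wirtinger

/-! ### Pure states, logarithmic derivatives and quantum Fisher information -/

section Quantum

variable {H : Type*} [NormedAddCommGroup H] [InnerProductSpace ℂ H] {k : ℕ}

/-- The density operator `|v⟩⟨v|`. -/
def density (v : H) : H →L[ℂ] H := InnerProductSpace.rankOne ℂ v v

/-- `L` is a family of complex symmetric logarithmic derivatives at `θ₀` of the pure state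
`ρ = |ψ⟩⟨ψ|`: for every entry `a` of `(θ, θ^*)`, `∂_a ρ = (ρ L_a + L_a ρ) / 2`. -/
def IsComplexSLD (ψ : (Fin k → ℂ) → H) (θ₀ : Fin k → ℂ)
    (L : Fin k ⊕ Fin k → H →L[ℂ] H) : Prop :=
  ∀ a : Fin k ⊕ Fin k, dhat (fun θ => density (ψ θ)) θ₀ a =
    (1 / 2 : ℂ) • (density (ψ θ₀) * L a + L a * density (ψ θ₀))

/-- `⟨v|A|v⟩`, which is `Tr (|v⟩⟨v| A)`. -/
def expval (v : H) (A : H →L[ℂ] H) : ℂ := ⟪v, A v⟫_ℂ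

/-- The block `J`: `J_ij = Tr (ρ (L_{θ_i^*} L_{θ_j} + L_{θ_j} L_{θ_i^*})) / 2`. -/
def fisherBlock (v : H) (L : Fin k ⊕ Fin k → H →L[ℂ] H) : Matrix (Fin k) (Fin k) ℂ :=
  Matrix.of fun i j => (1 / 2 : ℂ) *
    expval v (L (Sum.inr i) * L (Sum.inl j) + L (Sum.inl j) * L (Sum.inr i))

/-- The pseudo-information block `Q`:
`Q_ij = Tr (ρ (L_{θ_i^*} L_{θ_j^*} + L_{θ_j^*} L_{θ_i^*})) / 2`. -/
def pseudoFisherBlock (v : H) (L : Fin k ⊕ Fin k → H →L[ℂ] H) : Matrix (Fin k) (Fin k) ℂ :=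
  Matrix.of fun i j => (1 / 2 : ℂ) *
    expval v (L (Sum.inr i) * L (Sum.inr j) + L (Sum.inr j) * L (Sum.inr i))

/-- The symmetric quantum Fisher information matrix for the conjugate extension `(θ, θ^*)`. -/
def sqfim (v : H) (L : Fin k ⊕ Fin k → H →L[ℂ] H) :
    Matrix (Fin k ⊕ Fin k) (Fin k ⊕ Fin k) ℂ :=
  Matrix.fromBlocks (fisherBlock v L) (pseudoFisherBlock v L)
    ((pseudoFisherBlock v L).map conj) ((fisherBlock v L).map conj)

end Quantum

/-! ### Generalized measurements and the Born rule -/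

/-- A generalized measurement (positive operator valued measure) on `H` with outcomes in `Ω`.
The values of `effect` on non-measurable sets are irrelevant. -/
structure POVM (Ω : Type*) [MeasurableSpace Ω] (H : Type*) [NormedAddCommGroup H]
    [InnerProductSpace ℂ H] where
  /-- the effect of an event -/
  effect : Set Ω → H →L[ℂ] H
  isPositive : ∀ B, MeasurableSet B → (effect B).IsPositive
  effect_univ : effect Set.univ = 1
  hasSum_iUnion : ∀ B : ℕ → Set Ω, (∀ n, MeasurableSet (B n)) →
    Pairwise (Function.onFun Disjoint B) → ∀ v w : H,
      HasSum (fun n => ⟪v, effect (B n) w⟫_ℂ) ⟪v, effect (⋃ n, B n) w⟫_ℂ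

section Measurement

variable {Ω : Type*} [MeasurableSpace Ω] {H : Type*} [NormedAddCommGroup H]
  [InnerProductSpace ℂ H]

theorem POVM.re_inner_nonneg (M : POVM Ω H) {B : Set Ω} (hB : MeasurableSet B) (v : H) :
    0 ≤ (⟪v, M.effect B v⟫_ℂ).re :=
  (M.isPositive B hB).re_inner_nonneg_right v

theorem POVM.inner_empty (M : POVM Ω H) (v : H) : ⟪v, M.effect ∅ v⟫_ℂ = 0 := by
  have h := M.hasSum_iUnion (fun _ => ∅) (fun _ => MeasurableSet.empty)
    (fun _ _ _ => disjoint_bot_left) v v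
  exact tendsto_nhds_unique tendsto_const_nhds h.summable.tendsto_atTop_zero

/-- The Born rule: the law `B ↦ ⟨v|M(B)|v⟩` of the outcome in the pure state `v`. -/
def POVM.law (M : POVM Ω H) (v : H) : Measure Ω :=
  Measure.ofMeasurable (fun B _ => ENNReal.ofReal (⟪v, M.effect B v⟫_ℂ).re)
    (by simp [M.inner_empty v])
    (by
      intro B hB hd
      have h := Complex.hasSum_re (M.hasSum_iUnion B hB hd v v)
      rw [← h.tsum_eq]
      exact ENNReal.ofReal_tsum_of_nonneg (fun n => M.re_inner_nonneg (hB n) v) h.summable)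

variable {k : ℕ}

/-- The expectation of a complex statistic `t` under the law `P`. -/
def mean (P : Measure Ω) (t : Ω → (Fin k → ℂ)) : Fin k → ℂ := fun i => ∫ ω, t ω i ∂P

/-- The conjugate extension `(t, t^*)` of a complex statistic. -/
def conjExt (t : Ω → (Fin k → ℂ)) (ω : Ω) : Fin k ⊕ Fin k → ℂ :=
  Sum.elim (t ω) (fun i => conj (t ω i))

/-- The covariance matrix `E ((t̂ - E t̂) (t̂ - E t̂)^†)` of the conjugate extension `t̂` of `t`. -/
def covHat (P : Measure Ω) (t : Ω → (Fin k → ℂ)) :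
    Matrix (Fin k ⊕ Fin k) (Fin k ⊕ Fin k) ℂ :=
  Matrix.of fun a b => ∫ ω, (conjExt t ω a - ∫ ω', conjExt t ω' a ∂P) *
    conj (conjExt t ω b - ∫ ω', conjExt t ω' b ∂P) ∂P

/-- The statistic `t` of the outcome of the measurement `M` is a locally unbiased estimator of
the complex parameter at `θ₀`: it is measurable, its second moment is bounded near `θ₀`, and
`g(θ) = E_θ t` satisfies `g(θ₀) = θ₀` and has there the identity as Wirtinger Jacobian. -/
structure IsLocallyUnbiased (ψ : (Fin k → ℂ) → H) (θ₀ : Fin k → ℂ) (M : POVM Ω H)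
    (t : Ω → (Fin k → ℂ)) : Prop where
  measurable : Measurable t
  second_moment : ∃ C : ℝ≥0, ∀ᶠ θ in 𝓝 θ₀, ∀ i, ∫⁻ ω, ‖t ω i‖ₑ ^ 2 ∂(M.law (ψ θ)) ≤ C
  mean_eq : mean (M.law (ψ θ₀)) t = θ₀
  hasPartials : ∀ i, HasPartials (fun θ => mean (M.law (ψ θ)) t i) θ₀
  jacobian_eq : jacobianHat (fun θ => mean (M.law (ψ θ)) t) θ₀ = 1

end Measurement

/-- The symmetric quantum Cramér-Rao bound is attained at `θ₀` by some generalized measurement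
and some locally unbiased estimator: `Cov(t̂) = 𝒥⁻¹`. -/
def BoundAttainable {H : Type*} [NormedAddCommGroup H] [InnerProductSpace ℂ H] {k : ℕ}
    (ψ : (Fin k → ℂ) → H) (θ₀ : Fin k → ℂ) (L : Fin k ⊕ Fin k → H →L[ℂ] H) : Prop :=
  ∃ (Ω : Type) (_ : MeasurableSpace Ω) (M : POVM Ω H) (t : Ω → (Fin k → ℂ)),
    IsLocallyUnbiased ψ θ₀ M t ∧ covHat (M.law (ψ θ₀)) t = (sqfim (ψ θ₀) L)⁻¹

end ComplexQCRB

end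

noncomputable section

namespace ComplexQCRB

/-! ### Integration of simple functions against a generalized measurement -/

section SimpleIntegral

variable {H : Type*} [NormedAddCommGroup H] [InnerProductSpace ℂ H]

/-! Write v = ψ(θ₀), let l_x = 2(∂_xψ − ⟨v, ∂_xψ⟩v) be the horizontal vectors of the 2k real
coordinates, G their complex Gram matrix and F = Re G. A logarithmic derivative enters only through
L_a v and ⟨v|L_a, and both are Wirtinger combinations of the l_x (`IsComplexSLD.apply_eq`). Hence
the information matrix is W†FW and the commutator expectations form Wᵀ(G − Gᵀ)W, where W is
invertible and G − Gᵀ = 2i Im G. The covariance transforms inversely (`covHat_eq`,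
`conj_mul_eq_inv_iff`), so the claim becomes: some locally unbiased estimator has real covariance C
= F⁻¹ if and only if Im G = 0.

Necessity. A square integrable real statistic f gives a vector X_f = ∫ f dM v, and ‖X_f + iX_g‖² ≤ ∫
(f² + g²). For the coordinate errors, local unbiasedness says Re⟨l_y, X_x⟩ = δ_xy. If C = F⁻¹, the
vectors m_x = ∑ C_xz l_z satisfy Re⟨m_x, X_x⟩ = ‖m_x‖² = C_xx ≥ ‖X_x‖², which forces X_x = m_x. Then
‖m_x + i m_y‖² ≤ C_xx + C_yy means Im⟨m_x, m_y⟩ ≥ 0; exchanging x and y gives equality, and the l_x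
are real combinations of the m_x. The analytic core is that the mean of an unbounded f has
derivative 2 Re⟨∂ψ, X_f⟩ (`POVM.hasDerivAt_integral_law`), which rests on weak continuity of u ↦ ∫ f
dM u under locally bounded second moments.

Sufficiency. If G is real, a real change of basis normalizing F makes the l_x into an orthonormal
family e_j orthogonal to v. A finite measurement along v ± √(n + 1) e_j, n = 2k, then measures all
the operators |m_x⟩⟨v| + |v⟩⟨m_x| at once, with covariance exactly F⁻¹ at θ₀. -/

theorem norm_inner_sq_le_of_isPositive [CompleteSpace H] {T : H →L[ℂ] H} (hT : T.IsPositive)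
    (w u : H) : ‖⟪w, T u⟫_ℂ‖ ^ 2 ≤ (⟪w, T w⟫_ℂ).re * (⟪u, T u⟫_ℂ).re := by
  obtain ⟨S, rfl⟩ := CStarAlgebra.nonneg_iff_eq_star_mul_self.1
    ((ContinuousLinearMap.nonneg_iff_isPositive T).2 hT)
  have h (x y : H) : ⟪x, (star S * S) y⟫_ℂ = ⟪S x, S y⟫_ℂ := by
    rw [ContinuousLinearMap.star_eq_adjoint, mul_apply_eq_comp,
      ContinuousLinearMap.adjoint_inner_right]
  have h2 (x : H) : (⟪S x, S x⟫_ℂ).re = ‖S x‖ ^ 2 := by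
    rw [inner_self_eq_norm_sq_to_K]; norm_cast
  rw [h, h, h, h2, h2, ← mul_pow]
  gcongr
  exact norm_inner_le_norm _ _

theorem inner_eq_re_of_isPositive {T : H →L[ℂ] H} (hT : T.IsPositive) (u : H) :
    ⟪u, T u⟫_ℂ = ((⟪u, T u⟫_ℂ).re : ℂ) := by
  have := hT.inner_nonneg_right u
  rw [Complex.nonneg_iff] at this
  exact Complex.ext (by simp) (by simp [← this.2])

/-- Complex polarization. It lets every identity between operators ∫ f dM be checked as an identity
of integrals against the laws. -/
theorem ext_of_inner_self {S T : H →L[ℂ] H} (h : ∀ u, ⟪u, S u⟫_ℂ = ⟪u, T u⟫_ℂ) : S = T := by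
  have := (ext_inner_map (S : H →ₗ[ℂ] H) (T : H →ₗ[ℂ] H)).1 fun u => by
    have h' := congrArg conj (h u)
    rwa [inner_conj_symm, inner_conj_symm] at h'
  exact ContinuousLinearMap.coe_injective this

variable {Ω : Type*} [MeasurableSpace Ω] (M : POVM Ω H)

theorem POVM.law_apply (v : H) {B : Set Ω} (hB : MeasurableSet B) :
    M.law v B = ENNReal.ofReal (⟪v, M.effect B v⟫_ℂ).re :=
  Measure.ofMeasurable_apply B hB

theorem POVM.law_real (v : H) {B : Set Ω} (hB : MeasurableSet B) :
    (M.law v).real B = (⟪v, M.effect B v⟫_ℂ).re := by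
  rw [Measure.real, M.law_apply v hB, ENNReal.toReal_ofReal (M.re_inner_nonneg hB v)]

theorem POVM.inner_effect (v : H) {B : Set Ω} (hB : MeasurableSet B) :
    ⟪v, M.effect B v⟫_ℂ = ((M.law v).real B : ℂ) := by
  rw [M.law_real v hB, ← inner_eq_re_of_isPositive (M.isPositive B hB)]

instance POVM.isFiniteMeasure_law (v : H) : IsFiniteMeasure (M.law v) :=
  ⟨by rw [M.law_apply v MeasurableSet.univ]; exact ENNReal.ofReal_lt_top⟩

theorem POVM.law_real_univ (v : H) : (M.law v).real Set.univ = ‖v‖ ^ 2 := by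
  rw [M.law_real v MeasurableSet.univ, M.effect_univ, one_apply_eq_self,
    inner_self_eq_norm_sq_to_K]
  norm_cast

theorem POVM.isProbabilityMeasure_law {v : H} (hv : ‖v‖ = 1) :
    IsProbabilityMeasure (M.law v) := by
  constructor
  have h := M.law_real_univ v
  rw [hv, one_pow, Measure.real] at h
  rwa [← ENNReal.toReal_eq_one_iff]

/-- The operator `∫ f dM` for a simple function `f`. -/
def POVM.op (f : SimpleFunc Ω ℂ) : H →L[ℂ] H := ∑ c ∈ f.range, c • M.effect (f ⁻¹' {c})

/-- A simple function is integrable with respect to a finite measure, whatever its values. -/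
theorem integrable_simpleFunc {E : Type*} [NormedAddCommGroup E] (f : SimpleFunc Ω E)
    (P : Measure Ω) [IsFiniteMeasure P] : Integrable f P :=
  SimpleFunc.integrable_of_isFiniteMeasure f

theorem POVM.inner_op (f : SimpleFunc Ω ℂ) (u : H) :
    ⟪u, M.op f u⟫_ℂ = ∫ ω, f ω ∂(M.law u) := by
  rw [SimpleFunc.integral_eq_sum f (integrable_simpleFunc f _), POVM.op,
    _root_.sum_apply, inner_sum]
  refine Finset.sum_congr rfl fun c _ => ?_
  rw [_root_.smul_apply, inner_smul_right,
    M.inner_effect u (f.measurableSet_fiber c), mul_comm]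
  rfl

theorem POVM.op_add (f g : SimpleFunc Ω ℂ) : M.op (f + g) = M.op f + M.op g :=
  ext_of_inner_self fun u => by
    rw [_root_.add_apply, inner_add_right, M.inner_op, M.inner_op, M.inner_op,
      ← integral_add (integrable_simpleFunc f _) (integrable_simpleFunc g _)]
    rfl

theorem POVM.op_sub (f g : SimpleFunc Ω ℂ) : M.op (f - g) = M.op f - M.op g :=
  ext_of_inner_self fun u => by
    rw [_root_.sub_apply, inner_sub_right, M.inner_op, M.inner_op, M.inner_op,
      ← integral_sub (integrable_simpleFunc f _) (integrable_simpleFunc g _)]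
    rfl

theorem POVM.op_smul (c : ℂ) (f : SimpleFunc Ω ℂ) : M.op (c • f) = c • M.op f :=
  ext_of_inner_self fun u => by
    rw [_root_.smul_apply, inner_smul_right, M.inner_op, M.inner_op,
      ← integral_const_mul]
    rfl

/-- The operator may be computed on any finite partition on which the function is constant, not only
on its own level sets; two functions can thus share one partition. -/
theorem POVM.op_map {β : Type*} (f : SimpleFunc Ω β) (g : β → ℂ) :
    M.op (f.map g) = ∑ c ∈ f.range, g c • M.effect (f ⁻¹' {c}) :=
  ext_of_inner_self fun u => by
    classical
    have h : ∀ ω, f.map g ω = ∑ c ∈ f.range, (f ⁻¹' {c}).indicator (fun _ => g c) ω := by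
      intro ω
      rw [Finset.sum_eq_single (f ω)]
      · simp
      · intro c _ hc
        simp [Set.indicator, hc.symm]
      · intro hω
        exact absurd (f.mem_range_self ω) hω
    rw [M.inner_op, integral_congr_ae (ae_of_all _ h), integral_finsetSum,
      _root_.sum_apply, inner_sum]
    · refine Finset.sum_congr rfl fun c _ => ?_
      rw [integral_indicator_const _ (f.measurableSet_fiber c), _root_.smul_apply,
        inner_smul_right, M.inner_effect u (f.measurableSet_fiber c), mul_comm]
      rfl
    · intro c _
      exact (integrable_const _).indicator (f.measurableSet_fiber c)

theorem POVM.sum_effect {β : Type*} (f : SimpleFunc Ω β) (g : β → ℝ) (u : H) :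
    ∑ c ∈ f.range, g c * (⟪u, M.effect (f ⁻¹' {c}) u⟫_ℂ).re = ∫ ω, g (f ω) ∂(M.law u) := by
  have h := M.inner_op (f.map fun c => (g c : ℂ)) u
  rw [M.op_map, _root_.sum_apply, inner_sum] at h
  have h' : ∫ ω, (f.map fun c => (g c : ℂ)) ω ∂(M.law u) =
      ((∫ ω, g (f ω) ∂(M.law u) : ℝ) : ℂ) := integral_ofReal
  rw [h'] at h
  have := congrArg Complex.re h
  rw [Complex.ofReal_re, Complex.re_sum] at this
  rw [← this]
  refine Finset.sum_congr rfl fun c _ => ?_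
  rw [_root_.smul_apply, inner_smul_right, Complex.re_ofReal_mul]

/-- The Cauchy-Schwarz inequality for the sesquilinear form `∫ φ χ d⟨w, M u⟩`. -/
theorem POVM.norm_inner_op_mul_sq_le [CompleteSpace H] (φ χ : SimpleFunc Ω ℂ) (w u : H) :
    ‖⟪w, M.op (φ * χ) u⟫_ℂ‖ ^ 2 ≤
      (∫ ω, ‖φ ω‖ ^ 2 ∂(M.law w)) * ∫ ω, ‖χ ω‖ ^ 2 ∂(M.law u) := by
  -- Both functions are constant on the fibres of the pair. Cauchy-Schwarz for each positive effect,
  -- then for the finite sum over fibres, gives the bound.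
  set p := φ.pair χ with hp
  have hmul : φ * χ = p.map fun c => c.1 * c.2 := by ext ω; simp [hp]
  have hpos (c : ℂ × ℂ) := M.isPositive _ (p.measurableSet_fiber c)
  set a : ℂ × ℂ → H → ℝ := fun c x => (⟪x, M.effect (p ⁻¹' {c}) x⟫_ℂ).re with ha
  have ha0 (c x) : 0 ≤ a c x := M.re_inner_nonneg (p.measurableSet_fiber c) x
  have hφ : ∫ ω, ‖φ ω‖ ^ 2 ∂(M.law w) = ∑ c ∈ p.range, (‖c.1‖ * √(a c w)) ^ 2 := by
    have := M.sum_effect p (fun c => ‖c.1‖ ^ 2) w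
    simp only [hp, SimpleFunc.pair_apply] at this
    rw [← this]
    exact Finset.sum_congr rfl fun c _ => by rw [mul_pow, Real.sq_sqrt (ha0 c w)]
  have hχ : ∫ ω, ‖χ ω‖ ^ 2 ∂(M.law u) = ∑ c ∈ p.range, (‖c.2‖ * √(a c u)) ^ 2 := by
    have := M.sum_effect p (fun c => ‖c.2‖ ^ 2) u
    simp only [hp, SimpleFunc.pair_apply] at this
    rw [← this]
    exact Finset.sum_congr rfl fun c _ => by rw [mul_pow, Real.sq_sqrt (ha0 c u)]
  rw [hφ, hχ]
  refine le_trans ?_ (Finset.sum_mul_sq_le_sq_mul_sq _ _ _)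
  gcongr
  rw [hmul, M.op_map, _root_.sum_apply, inner_sum]
  refine (norm_sum_le _ _).trans (Finset.sum_le_sum fun c _ => ?_)
  rw [_root_.smul_apply, inner_smul_right, norm_mul, norm_mul]
  have h1 : ‖⟪w, M.effect (p ⁻¹' {c}) u⟫_ℂ‖ ≤ √(a c w) * √(a c u) := by
    rw [← Real.sqrt_mul (ha0 c w)]
    exact Real.le_sqrt_of_sq_le (norm_inner_sq_le_of_isPositive (hpos c) w u)
  calc _ ≤ ‖c.1‖ * ‖c.2‖ * (√(a c w) * √(a c u)) := by gcongr
    _ = _ := by ring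

/-- Cauchy-Schwarz with φ = 1 and w = ∫ f dM u, divided by ‖w‖². This contraction from L² of the law
replaces a Naimark dilation. -/
theorem POVM.norm_op_apply_sq_le [CompleteSpace H] (f : SimpleFunc Ω ℂ) (u : H) :
    ‖M.op f u‖ ^ 2 ≤ ∫ ω, ‖f ω‖ ^ 2 ∂(M.law u) := by
  have h := M.norm_inner_op_mul_sq_le 1 f (M.op f u) u
  have h1 : ∫ ω, ‖(1 : SimpleFunc Ω ℂ) ω‖ ^ 2 ∂(M.law (M.op f u)) = ‖M.op f u‖ ^ 2 := by
    simp [M.law_real_univ]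
  rw [one_mul, h1, inner_self_eq_norm_sq_to_K] at h
  rcases eq_or_ne (‖M.op f u‖) 0 with h0 | h0
  · rw [h0]
    simpa using integral_nonneg fun ω => by positivity
  · have h2 : ‖((‖M.op f u‖ : ℂ)) ^ 2‖ = ‖M.op f u‖ ^ 2 := by simp
    have h3 : 0 < ‖M.op f u‖ ^ 2 := by positivity
    erw [h2, sq (‖M.op f u‖ ^ 2)] at h
    exact le_of_mul_le_mul_left h h3

theorem POVM.inner_op_ofReal_comm [CompleteSpace H] (f : SimpleFunc Ω ℝ) (w u : H) :
    ⟪M.op (f.map Complex.ofReal) w, u⟫_ℂ = ⟪w, M.op (f.map Complex.ofReal) u⟫_ℂ := by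
  have h : ContinuousLinearMap.adjoint (M.op (f.map Complex.ofReal)) =
      M.op (f.map Complex.ofReal) := ext_of_inner_self fun x => by
    rw [ContinuousLinearMap.adjoint_inner_right, ← inner_conj_symm, M.inner_op]
    have : ∫ ω, (f.map Complex.ofReal) ω ∂(M.law x) = ((∫ ω, f ω ∂(M.law x) : ℝ) : ℂ) :=
      integral_ofReal
    rw [this, Complex.conj_ofReal]
  conv_rhs => rw [← h, ContinuousLinearMap.adjoint_inner_right]

end SimpleIntegral

/-! ### Square integrable statistics -/

section SquareIntegrable

variable {Ω : Type*} [MeasurableSpace Ω] {f g : Ω → ℝ}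

/-- Simple functions converging pointwise to a measurable real function. -/
def realApprox (hf : Measurable f) (N : ℕ) : SimpleFunc Ω ℝ :=
  SimpleFunc.approxOn f hf Set.univ 0 (Set.mem_univ 0) N

theorem norm_realApprox_le (hf : Measurable f) (N : ℕ) (ω : Ω) :
    |realApprox hf N ω| ≤ 2 * |f ω| := by
  have := SimpleFunc.norm_approxOn_zero_le hf (Set.mem_univ 0) ω N
  simp only [Real.norm_eq_abs] at this
  rw [two_mul]
  exact this

theorem tendsto_realApprox (hf : Measurable f) (ω : Ω) :
    Tendsto (fun N => realApprox hf N ω) atTop (𝓝 (f ω)) :=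
  SimpleFunc.tendsto_approxOn hf (Set.mem_univ 0) (by simp)

theorem tendsto_integral_realApprox (hf : Measurable f) {P : Measure Ω} [IsFiniteMeasure P]
    (h : MemLp f 2 P) : Tendsto (fun N => ∫ ω, realApprox hf N ω ∂P) atTop (𝓝 (∫ ω, f ω ∂P)) := by
  refine tendsto_integral_of_dominated_convergence (fun ω => 2 * |f ω|)
    (fun N => (realApprox hf N).aestronglyMeasurable)
    (((h.integrable one_le_two).abs).const_mul 2) (fun N => ae_of_all _ fun ω => ?_)
    (ae_of_all _ fun ω => tendsto_realApprox hf ω)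
  exact norm_realApprox_le hf N ω

theorem tendsto_integral_realApprox_sq (hf : Measurable f) {P : Measure Ω}
    (h : MemLp f 2 P) :
    Tendsto (fun N => ∫ ω, realApprox hf N ω ^ 2 ∂P) atTop (𝓝 (∫ ω, f ω ^ 2 ∂P)) := by
  refine tendsto_integral_of_dominated_convergence (fun ω => 4 * f ω ^ 2)
    (fun N => ((realApprox hf N).measurable.pow_const 2).aestronglyMeasurable)
    (h.integrable_sq.const_mul 4) (fun N => ae_of_all _ fun ω => ?_)
    (ae_of_all _ fun ω => (tendsto_realApprox hf ω).pow 2)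
  have h1 := norm_realApprox_le hf N ω
  rw [Real.norm_eq_abs, abs_pow, ← sq_abs (f ω)]
  nlinarith [abs_nonneg (realApprox hf N ω)]

theorem tendsto_integral_realApprox_sub_sq (hf : Measurable f) {P : Measure Ω}
    (h : MemLp f 2 P) :
    Tendsto (fun N => ∫ ω, (realApprox hf N ω - f ω) ^ 2 ∂P) atTop (𝓝 0) := by
  have h0 : (0 : ℝ) = ∫ _ω, (0 : ℝ) ∂P := by simp
  rw [h0]
  refine tendsto_integral_of_dominated_convergence (fun ω => 9 * f ω ^ 2)
    (fun N => (((realApprox hf N).measurable.sub hf).pow_const 2).aestronglyMeasurable)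
    (h.integrable_sq.const_mul 9) (fun N => ae_of_all _ fun ω => ?_)
    (ae_of_all _ fun ω => ?_)
  · have h1 := norm_realApprox_le hf N ω
    have h2 := abs_sub (realApprox hf N ω) (f ω)
    rw [Real.norm_eq_abs, abs_pow, ← sq_abs (f ω)]
    nlinarith [abs_nonneg (realApprox hf N ω - f ω), abs_nonneg (f ω)]
  · simpa using ((tendsto_realApprox hf ω).sub_const (f ω)).pow 2

/-! ### The vectors ∫ f dM u and their weak continuity in u -/

variable {H : Type*} [NormedAddCommGroup H] [InnerProductSpace ℂ H] (M : POVM Ω H)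

/-- The operator `∫ f_N dM` for the `N`-th simple approximation `f_N` of `f`. -/
def POVM.opApprox (hf : Measurable f) (N : ℕ) : H →L[ℂ] H :=
  M.op ((realApprox hf N).map Complex.ofReal)

/-- The vector `∫ f dM u` for a real statistic `f` that is square integrable under the
law of the outcome in the state `u`. -/
def POVM.integralVec (hf : Measurable f) (u : H) : H :=
  limUnder atTop fun N => M.opApprox hf N u

theorem POVM.inner_opApprox (hf : Measurable f) (N : ℕ) (u : H) :
    ⟪u, M.opApprox hf N u⟫_ℂ = ((∫ ω, realApprox hf N ω ∂(M.law u) : ℝ) : ℂ) := by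
  rw [POVM.opApprox, M.inner_op]
  exact integral_ofReal

variable [CompleteSpace H]

theorem POVM.tendsto_integralVec (hf : Measurable f) {u : H} (h : MemLp f 2 (M.law u)) :
    Tendsto (fun N => M.opApprox hf N u) atTop (𝓝 (M.integralVec hf u)) := by
  refine CauchySeq.tendsto_limUnder (Metric.cauchySeq_iff'.2 fun ε hε => ?_)
  have h0 := (tendsto_integral_realApprox_sub_sq hf h).eventually_lt_const
    (show (0 : ℝ) < ε ^ 2 / 4 by positivity)
  obtain ⟨N, hN⟩ := eventually_atTop.1 h0
  refine ⟨N, fun n hn => ?_⟩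
  have hint (n) : Integrable (fun ω => (realApprox hf n ω - f ω) ^ 2) (M.law u) :=
    ((SimpleFunc.memLp_of_isFiniteMeasure (realApprox hf n) 2 _).sub h).integrable_sq
  have h1 : ‖M.opApprox hf n u - M.opApprox hf N u‖ ^ 2 < ε ^ 2 := by
    rw [POVM.opApprox, POVM.opApprox, ← _root_.sub_apply, ← M.op_sub]
    refine (M.norm_op_apply_sq_le _ u).trans_lt ?_
    calc _ ≤ ∫ ω, (2 * (realApprox hf n ω - f ω) ^ 2 + 2 * (realApprox hf N ω - f ω) ^ 2)
          ∂(M.law u) := by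
          refine integral_mono_of_nonneg (ae_of_all _ fun ω => by positivity)
            (((hint n).const_mul 2).add ((hint N).const_mul 2)) (ae_of_all _ fun ω => ?_)
          simp only [SimpleFunc.coe_sub, SimpleFunc.coe_map, Pi.sub_apply, Function.comp_apply]
          rw [← Complex.ofReal_sub, Complex.norm_real, Real.norm_eq_abs, sq_abs]
          nlinarith [sq_nonneg (realApprox hf n ω - f ω + (realApprox hf N ω - f ω))]
      _ = 2 * (∫ ω, (realApprox hf n ω - f ω) ^ 2 ∂(M.law u)) +
          2 * ∫ ω, (realApprox hf N ω - f ω) ^ 2 ∂(M.law u) := by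
          rw [integral_add ((hint n).const_mul 2) ((hint N).const_mul 2), integral_const_mul,
            integral_const_mul]
      _ < ε ^ 2 := by linarith [hN n hn, hN N le_rfl]
  rw [dist_eq_norm]
  exact lt_of_pow_lt_pow_left₀ 2 hε.le h1

theorem POVM.inner_integralVec (hf : Measurable f) {u : H} (h : MemLp f 2 (M.law u)) :
    ⟪u, M.integralVec hf u⟫_ℂ = ((∫ ω, f ω ∂(M.law u) : ℝ) : ℂ) := by
  refine tendsto_nhds_unique (tendsto_const_nhds.inner (M.tendsto_integralVec hf h)) ?_
  simp only [M.inner_opApprox hf]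
  exact (Complex.continuous_ofReal.tendsto _).comp (tendsto_integral_realApprox hf h)

/-- The L² contraction for the complex function f + ig, whose squared modulus has no cross term. The
vector side does have one, −2 Im⟨X_f, X_g⟩, and this is the source of the commutation relations. -/
theorem POVM.norm_integralVec_add_sq_le (hf : Measurable f) (hg : Measurable g) {u : H}
    (h : MemLp f 2 (M.law u)) (h' : MemLp g 2 (M.law u)) :
    ‖M.integralVec hf u + Complex.I • M.integralVec hg u‖ ^ 2 ≤
      (∫ ω, f ω ^ 2 ∂(M.law u)) + ∫ ω, g ω ^ 2 ∂(M.law u) := by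
  refine le_of_tendsto_of_tendsto'
    (((M.tendsto_integralVec hf h).add ((M.tendsto_integralVec hg h').const_smul
      Complex.I)).norm.pow 2)
    ((tendsto_integral_realApprox_sq hf h).add (tendsto_integral_realApprox_sq hg h'))
    fun N => ?_
  rw [POVM.opApprox, POVM.opApprox, ← _root_.smul_apply, ← M.op_smul, ← _root_.add_apply,
    ← M.op_add]
  refine (M.norm_op_apply_sq_le _ u).trans_eq ?_
  have hi (s : SimpleFunc Ω ℝ) : Integrable (fun ω => s ω ^ 2) (M.law u) :=
    (SimpleFunc.memLp_of_isFiniteMeasure s 2 _).integrable_sq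
  rw [← integral_add (hi _) (hi _)]
  refine integral_congr_ae (ae_of_all _ fun ω => ?_)
  simp only [SimpleFunc.coe_add, SimpleFunc.coe_map, Pi.add_apply, Function.comp_apply,
    SimpleFunc.coe_smul, Pi.smul_apply, smul_eq_mul]
  rw [← Complex.normSq_eq_norm_sq, mul_comm Complex.I, Complex.normSq_add_mul_I]

theorem POVM.norm_integralVec_sq_le (hf : Measurable f) {u : H} (h : MemLp f 2 (M.law u)) :
    ‖M.integralVec hf u‖ ^ 2 ≤ ∫ ω, f ω ^ 2 ∂(M.law u) := by
  refine le_of_tendsto_of_tendsto' ((M.tendsto_integralVec hf h).norm.pow 2)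
    (tendsto_integral_realApprox_sq hf h) fun N => ?_
  refine (M.norm_op_apply_sq_le _ u).trans_eq ?_
  refine integral_congr_ae (ae_of_all _ fun ω => ?_)
  simp

/-- For symmetric T, ⟨u, Tu⟩ − ⟨v, Tv⟩ = Re⟨u − v, Tu + Tv⟩. This is used for the simple
approximations and passes to the limit, although f itself need not define a bounded operator. -/
theorem POVM.integral_sub_integral (hf : Measurable f) {u v : H} (hu : MemLp f 2 (M.law u))
    (hv : MemLp f 2 (M.law v)) :
    (∫ ω, f ω ∂(M.law u)) - ∫ ω, f ω ∂(M.law v) =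
      (⟪u - v, M.integralVec hf u + M.integralVec hf v⟫_ℂ).re := by
  refine tendsto_nhds_unique
    ((tendsto_integral_realApprox hf hu).sub (tendsto_integral_realApprox hf hv)) ?_
  have h1 := (Complex.continuous_re.tendsto _).comp ((tendsto_const_nhds (x := u - v)).inner
    ((M.tendsto_integralVec hf hu).add (M.tendsto_integralVec hf hv)) (𝕜 := ℂ))
  refine h1.congr fun N => ?_
  have h2 := congrArg Complex.re (M.inner_opApprox hf N u)
  have h3 := congrArg Complex.re (M.inner_opApprox hf N v)
  have h4 : (⟪v, M.opApprox hf N u⟫_ℂ).re = (⟪u, M.opApprox hf N v⟫_ℂ).re := by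
    rw [POVM.opApprox, ← M.inner_op_ofReal_comm, ← inner_conj_symm, Complex.conj_re]
  rw [Complex.ofReal_re] at h2 h3
  simp only [Function.comp_apply, inner_add_right, inner_sub_left, Complex.add_re, Complex.sub_re]
  rw [h2, h3, h4]
  ring

/-- The integral `∫ ((f - f_N) / (1 + |f| + |f_N|))² dP`, which controls the weak error of the
`N`-th simple approximation `f_N`. -/
def weakError (hf : Measurable f) (P : Measure Ω) (N : ℕ) : ℝ :=
  ∫ ω, ((f ω - realApprox hf N ω) / (1 + |f ω| + |realApprox hf N ω|)) ^ 2 ∂P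

theorem abs_div_one_add_le (a b : ℝ) : |(a - b) / (1 + |a| + |b|)| ≤ 1 := by
  have h : 0 < 1 + |a| + |b| := by positivity
  rw [abs_div, abs_of_pos h, div_le_one h]
  linarith [abs_sub a b]

/-- The weight keeps the integrand below 1, so dominated convergence needs no moment of f under P.
Later P is the law of an arbitrary vector, for which no such moment is available. -/
theorem tendsto_weakError (hf : Measurable f) (P : Measure Ω) [IsFiniteMeasure P] :
    Tendsto (weakError hf P) atTop (𝓝 0) := by
  have h0 : (0 : ℝ) = ∫ _ω, (0 : ℝ) ∂P := by simp
  rw [h0]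
  refine tendsto_integral_of_dominated_convergence (fun _ => 1) (fun N => ?_)
    (integrable_const _) (fun N => ae_of_all _ fun ω => ?_) (ae_of_all _ fun ω => ?_)
  · have := (realApprox hf N).measurable
    exact (by fun_prop : Measurable fun ω => ((f ω - realApprox hf N ω) /
      (1 + |f ω| + |realApprox hf N ω|)) ^ 2).aestronglyMeasurable
  · rw [Real.norm_eq_abs, abs_pow]
    exact pow_le_one₀ (abs_nonneg _) (abs_div_one_add_le _ _)
  · have h1 := tendsto_realApprox hf ω
    have h2 := ((tendsto_const_nhds (x := f ω)).sub h1).div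
      ((tendsto_const_nhds (x := 1 + |f ω|)).add h1.abs) (by positivity)
    simpa using h2.pow 2

/-- Factor f − f_N as φχ with χ = 1 + |f| + |f_N|, and apply Cauchy-Schwarz: the bounded small
factor φ is charged to the law of d, the growing factor χ to the law of u. The dependence on u is
only through its norm and second moment. -/
theorem POVM.norm_inner_integralVec_sub_sq_le (hf : Measurable f) {u : H}
    (h : MemLp f 2 (M.law u)) (d : H) (N : ℕ) :
    ‖⟪d, M.integralVec hf u - M.opApprox hf N u⟫_ℂ‖ ^ 2 ≤
      weakError hf (M.law d) N * (2 * ‖u‖ ^ 2 + 32 * ∫ ω, f ω ^ 2 ∂(M.law u)) := by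
  set s := realApprox hf N with hs
  have hsm := s.measurable
  have hlim : Tendsto (fun K => ∫ ω, ((realApprox hf K ω - s ω) /
      (1 + |realApprox hf K ω| + |s ω|)) ^ 2 ∂(M.law d)) atTop
      (𝓝 (weakError hf (M.law d) N)) := by
    refine tendsto_integral_of_dominated_convergence (fun _ => 1) (fun K => ?_)
      (integrable_const _) (fun K => ae_of_all _ fun ω => ?_) (ae_of_all _ fun ω => ?_)
    · have := (realApprox hf K).measurable
      exact (by fun_prop : Measurable fun ω => ((realApprox hf K ω - s ω) /
        (1 + |realApprox hf K ω| + |s ω|)) ^ 2).aestronglyMeasurable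
    · rw [Real.norm_eq_abs, abs_pow]
      exact pow_le_one₀ (abs_nonneg _) (abs_div_one_add_le _ _)
    · have h1 := tendsto_realApprox hf ω
      exact ((h1.sub_const (s ω)).div ((h1.abs.const_add 1).add_const |s ω|)
        (by positivity)).pow 2
  refine le_of_tendsto_of_tendsto'
    (((tendsto_const_nhds (x := d)).inner
      ((M.tendsto_integralVec hf h).sub_const (M.opApprox hf N u)) (𝕜 := ℂ)).norm.pow 2)
    (hlim.mul_const _) fun K => ?_
  set r := realApprox hf K with hr
  set p := r.pair s with hp
  set φ : SimpleFunc Ω ℂ := p.map fun c => ((c.1 - c.2) / (1 + |c.1| + |c.2|) : ℝ) with hφ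
  set χ : SimpleFunc Ω ℂ := p.map fun c => (1 + |c.1| + |c.2| : ℝ) with hχ
  have hmul : r.map Complex.ofReal - s.map Complex.ofReal = φ * χ := by
    ext ω
    simp only [SimpleFunc.coe_sub, SimpleFunc.coe_map, Pi.sub_apply, Function.comp_apply,
      SimpleFunc.coe_mul, Pi.mul_apply, hφ, hχ, hp, SimpleFunc.pair_apply]
    rw [← Complex.ofReal_mul, ← Complex.ofReal_sub, div_mul_cancel₀]
    positivity
  have h1 : M.opApprox hf K u - M.opApprox hf N u = M.op (φ * χ) u := by
    rw [← hmul, M.op_sub]; rfl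
  rw [h1]
  refine (M.norm_inner_op_mul_sq_le φ χ d u).trans ?_
  have h2 : ∫ ω, ‖φ ω‖ ^ 2 ∂(M.law d) =
      ∫ ω, ((r ω - s ω) / (1 + |r ω| + |s ω|)) ^ 2 ∂(M.law d) := by
    refine integral_congr_ae (ae_of_all _ fun ω => ?_)
    simp only [hφ, hp, SimpleFunc.coe_map, Function.comp_apply, SimpleFunc.pair_apply,
      Complex.norm_real, Real.norm_eq_abs, sq_abs]
  rw [h2]
  refine mul_le_mul_of_nonneg_left ?_ (integral_nonneg fun ω => by positivity)
  -- Both approximations are at most 2|f|, and (1 + 4|f|)² ≤ 2 + 32 f².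
  calc _ ≤ ∫ ω, (2 + 32 * f ω ^ 2) ∂(M.law u) := by
        refine integral_mono_of_nonneg (ae_of_all _ fun ω => by positivity)
          ((integrable_const _).add (h.integrable_sq.const_mul 32)) (ae_of_all _ fun ω => ?_)
        simp only [hχ, hp, SimpleFunc.coe_map, Function.comp_apply, SimpleFunc.pair_apply,
          Complex.norm_real, Real.norm_eq_abs, sq_abs]
        have ha := norm_realApprox_le hf K ω
        have hb := norm_realApprox_le hf N ω
        rw [← sq_abs (f ω)]
        have hc : 1 + |r ω| + |s ω| ≤ 1 + 4 * |f ω| := by linarith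
        have hd : 0 ≤ 1 + |r ω| + |s ω| := by positivity
        nlinarith [sq_nonneg (1 - 4 * |f ω|)]
    _ = _ := by
        rw [integral_add (integrable_const _) (h.integrable_sq.const_mul 32), integral_const,
          integral_const_mul, M.law_real_univ, smul_eq_mul, mul_comm]

/-- Vectors `∫ f dM u` with bounded second moments depend weakly continuously on `u`. -/
theorem POVM.tendsto_inner_integralVec (hf : Measurable f) {ι : Type*} {l : Filter ι}
    {U : ι → H} {v : H} (hU : Tendsto U l (𝓝 v)) {C : ℝ}
    (h : ∀ᶠ i in l, MemLp f 2 (M.law (U i)) ∧ ∫ ω, f ω ^ 2 ∂(M.law (U i)) ≤ C)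
    (hv : MemLp f 2 (M.law v)) (d : H) :
    Tendsto (fun i => ⟪d, M.integralVec hf (U i)⟫_ℂ) l (𝓝 ⟪d, M.integralVec hf v⟫_ℂ) := by
  -- One constant serving both the limit v and the nearby `U i`.
  set D : ℝ := 2 * (‖v‖ ^ 2 + 1) + 32 * (|C| + ∫ ω, f ω ^ 2 ∂(M.law v)) with hD
  have hI : 0 ≤ ∫ ω, f ω ^ 2 ∂(M.law v) := integral_nonneg fun ω => by positivity
  have hD0 : 0 < D := by positivity
  have hwe (N) : 0 ≤ weakError hf (M.law d) N := integral_nonneg fun ω => by positivity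
  have hbound {u : H} (hu : MemLp f 2 (M.law u)) (N) (hn : ‖u‖ ^ 2 ≤ ‖v‖ ^ 2 + 1)
      (hi : ∫ ω, f ω ^ 2 ∂(M.law u) ≤ |C| + ∫ ω, f ω ^ 2 ∂(M.law v)) :
      ‖⟪d, M.integralVec hf u - M.opApprox hf N u⟫_ℂ‖ ^ 2 ≤ weakError hf (M.law d) N * D := by
    refine (M.norm_inner_integralVec_sub_sq_le hf hu d N).trans ?_
    exact mul_le_mul_of_nonneg_left (by rw [hD]; linarith) (hwe N)
  rw [Metric.tendsto_nhds]
  intro ε hε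
  -- The weak error involves only d, so a single N works along the filter; for fixed N the
  -- approximating operator is bounded, hence continuous.
  obtain ⟨N, hN⟩ := (((tendsto_weakError hf (M.law d)).mul_const D).eventually_lt_const
    (show 0 * D < (ε / 3) ^ 2 by rw [zero_mul]; positivity)).exists
  have hnorm : ∀ᶠ i in l, ‖U i‖ ^ 2 ≤ ‖v‖ ^ 2 + 1 :=
    (hU.norm.pow 2).eventually_le_const (lt_add_one _)
  have hfix : Tendsto (fun i => ⟪d, M.opApprox hf N (U i)⟫_ℂ) l (𝓝 ⟪d, M.opApprox hf N v⟫_ℂ) :=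
    tendsto_const_nhds.inner (((M.opApprox hf N).continuous.tendsto v).comp hU)
  filter_upwards [h, hnorm, Metric.tendsto_nhds.1 hfix (ε / 3) (by positivity)]
    with i hi hni hfi
  have h1 := abs_lt_of_sq_lt_sq ((hbound hi.1 N hni (by linarith [hi.2, le_abs_self C])).trans_lt
    hN) (by positivity)
  have h2 := abs_lt_of_sq_lt_sq ((hbound hv N (by linarith) (by
    linarith [abs_nonneg C])).trans_lt hN) (by positivity)
  rw [abs_norm, inner_sub_right] at h1 h2
  rw [dist_eq_norm] at hfi ⊢
  calc _ = ‖(⟪d, M.integralVec hf (U i)⟫_ℂ - ⟪d, M.opApprox hf N (U i)⟫_ℂ) +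
        (⟪d, M.opApprox hf N (U i)⟫_ℂ - ⟪d, M.opApprox hf N v⟫_ℂ) -
        (⟪d, M.integralVec hf v⟫_ℂ - ⟪d, M.opApprox hf N v⟫_ℂ)‖ := by congr 1; ring
    _ ≤ _ := (norm_sub_le _ _).trans (add_le_add_left (norm_add_le _ _) _)
    _ < ε := by linarith

/-- The derivative of the mean of a statistic with locally bounded second moments along a
differentiable curve of vectors. -/
theorem POVM.hasDerivAt_integral_law (hf : Measurable f) {γ : ℝ → H} {d : H}
    (hγ : HasDerivAt γ d 0) {C : ℝ}
    (h : ∀ᶠ r in 𝓝 (0 : ℝ), MemLp f 2 (M.law (γ r)) ∧ ∫ ω, f ω ^ 2 ∂(M.law (γ r)) ≤ C) :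
    HasDerivAt (fun r => ∫ ω, f ω ∂(M.law (γ r)))
      (2 * (⟪d, M.integralVec hf (γ 0)⟫_ℂ).re) 0 := by
  have h0 := h.self_of_nhds.1
  have hs := hasDerivAt_iff_tendsto_slope_zero.1 hγ
  rw [hasDerivAt_iff_tendsto_slope_zero]
  have hc : Tendsto (fun r => γ (0 + r)) (𝓝[≠] (0 : ℝ)) (𝓝 (γ 0)) := by
    have := hγ.continuousAt.tendsto
    simpa using this.mono_left nhdsWithin_le_nhds
  have h' : ∀ᶠ r in 𝓝[≠] (0 : ℝ), MemLp f 2 (M.law (γ (0 + r))) ∧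
      ∫ ω, f ω ^ 2 ∂(M.law (γ (0 + r))) ≤ C := by
    simpa using h.filter_mono nhdsWithin_le_nhds
  -- With s_r the difference quotient, Re⟨s_r, Xγ_r + Xγ_0⟩ splits into ⟨d, Xγ_r⟩, ⟨s_r − d, Xγ_r⟩
  -- and ⟨s_r, Xγ_0⟩: weak convergence, strong convergence against a bounded vector, and strong
  -- convergence. The first and last share a limit, whence the factor 2.
  have h1 := M.tendsto_inner_integralVec hf hc h' h0 d
  have h2 : Tendsto (fun r : ℝ => ⟪r⁻¹ • (γ (0 + r) - γ 0) - d,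
      M.integralVec hf (γ (0 + r))⟫_ℂ) (𝓝[≠] (0 : ℝ)) (𝓝 0) := by
    have hz : Tendsto (fun r : ℝ => ‖r⁻¹ • (γ (0 + r) - γ 0) - d‖ * √C) (𝓝[≠] (0 : ℝ)) (𝓝 0) := by
      simpa using ((tendsto_iff_norm_sub_tendsto_zero.1 hs).mul_const (√C))
    refine squeeze_zero_norm' ?_ hz
    filter_upwards [h'] with r hr
    refine (norm_inner_le_norm _ _).trans ?_
    gcongr
    exact Real.le_sqrt_of_sq_le ((M.norm_integralVec_sq_le hf hr.1).trans hr.2)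
  have h3 : Tendsto (fun r : ℝ => ⟪r⁻¹ • (γ (0 + r) - γ 0), M.integralVec hf (γ 0)⟫_ℂ)
      (𝓝[≠] (0 : ℝ)) (𝓝 ⟪d, M.integralVec hf (γ 0)⟫_ℂ) := hs.inner tendsto_const_nhds
  have h4 := (Complex.continuous_re.tendsto _).comp ((h1.add h2).add h3)
  rw [add_zero, ← two_mul, show (2 : ℂ) = ((2 : ℝ) : ℂ) by norm_num, Complex.re_ofReal_mul] at h4
  refine h4.congr' ?_
  filter_upwards [h'] with r hr
  rw [M.integral_sub_integral hf hr.1 h0, smul_eq_mul]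
  simp only [Function.comp_apply]
  rw [← inner_add_left, add_sub_cancel, ← inner_add_right, RCLike.real_smul_eq_coe_smul (K := ℂ),
    inner_smul_left, RCLike.conj_ofReal]
  exact Complex.re_ofReal_mul _ _

end SquareIntegrable

/-! ### Measurements with finitely many outcomes -/

section FiniteMeasurement

variable {H : Type*} [NormedAddCommGroup H] [InnerProductSpace ℂ H]

open Classical in
/-- The measurement with finitely many outcomes given by positive operators adding up to `1`. -/
def POVM.ofFintype {ι : Type*} [Fintype ι] [MeasurableSpace ι] (E : ι → H →L[ℂ] H)
    (hE : ∀ i, (E i).IsPositive) (hsum : ∑ i, E i = 1) : POVM ι H where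
  effect B := ∑ i, if i ∈ B then E i else 0
  isPositive B _ := by
    refine ContinuousLinearMap.isPositive_sum _ fun i _ => ?_
    split_ifs
    exacts [hE i, ContinuousLinearMap.isPositive_zero]
  effect_univ := by simpa using hsum
  hasSum_iUnion B _ hd v w := by
    simp only [_root_.sum_apply, inner_sum]
    refine hasSum_sum fun i _ => ?_
    by_cases hi : i ∈ ⋃ n, B n
    · obtain ⟨n, hn⟩ := Set.mem_iUnion.1 hi
      rw [if_pos hi]
      have := hasSum_single (f := fun m => ⟪v, (if i ∈ B m then E i else 0) w⟫_ℂ) n fun m hm => by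
        rw [if_neg fun hm' => Set.disjoint_left.1 (hd hm) hm' hn]; simp
      simpa only [if_pos hn] using this
    · have h (n) : i ∉ B n := fun hn => hi (Set.mem_iUnion.2 ⟨n, hn⟩)
      simp only [if_neg hi, if_neg (h _)]
      simp

theorem POVM.integral_law_ofFintype {ι : Type*} [Fintype ι] [MeasurableSpace ι]
    [MeasurableSingletonClass ι] (E : ι → H →L[ℂ] H)
    (hE : ∀ i, (E i).IsPositive) (hsum : ∑ i, E i = 1) (u : H) (f : ι → ℝ) :
    ∫ i, f i ∂((POVM.ofFintype E hE hsum).law u) = ∑ i, (⟪u, E i u⟫_ℂ).re * f i := by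
  classical
  rw [integral_fintype .of_finite]
  refine Finset.sum_congr rfl fun i _ => ?_
  rw [POVM.law_real _ _ (measurableSet_singleton i), smul_eq_mul]
  congr 3
  simp [POVM.ofFintype]

end FiniteMeasurement

/-! ### The parity measurement along v ± √(n + 1) e_j -/

section ParityMeasurement

variable {H : Type*} [NormedAddCommGroup H] [InnerProductSpace ℂ H] {ι : Type*} [Fintype ι]

/-- The vectors `v ± √(n + 1) e_j` for an orthonormal family `v, e_1, …, e_n`. -/
def parityVec (v : H) (e : ι → H) (p : ι × Bool) : H :=
  v + ((if p.2 then √(Fintype.card ι + 1) else -√(Fintype.card ι + 1) : ℝ) : ℂ) • e p.1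

/-- The operators proportional to the projections to the vectors `v ± √(n + 1) e_j`, completed by
the remainder to a resolution of the identity. -/
def parityEffect (v : H) (e : ι → H) : Option (ι × Bool) → H →L[ℂ] H
  | none => 1 - ∑ p, ((1 / (2 * (Fintype.card ι + 1)) : ℝ) : ℂ) • density (parityVec v e p)
  | some p => ((1 / (2 * (Fintype.card ι + 1)) : ℝ) : ℂ) • density (parityVec v e p)

theorem sum_parityEffect (v : H) (e : ι → H) : ∑ o, parityEffect v e o = 1 := by
  simp [Fintype.sum_option, parityEffect]

theorem re_inner_density (v u : H) : (⟪u, density v u⟫_ℂ).re = ‖⟪v, u⟫_ℂ‖ ^ 2 := by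
  rw [density, InnerProductSpace.rankOne_apply, inner_smul_right, ← inner_conj_symm u v,
    Complex.mul_conj, Complex.ofReal_re, Complex.normSq_eq_norm_sq]

theorem re_inner_parityEffect_some (v : H) (e : ι → H) (u : H) (p : ι × Bool) :
    (⟪u, parityEffect v e (some p) u⟫_ℂ).re =
      1 / (2 * (Fintype.card ι + 1)) * ‖⟪parityVec v e p, u⟫_ℂ‖ ^ 2 := by
  rw [parityEffect, _root_.smul_apply, inner_smul_right, Complex.re_ofReal_mul, re_inner_density]

/-- The sign affects only the cross term: it cancels in the sum over `s`, which governs positivity,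
and survives in the difference, which gives the mean. -/
theorem normSq_inner_parityVec (v : H) (e : ι → H) (u : H) (j : ι) (s : Bool) :
    ‖⟪parityVec v e (j, s), u⟫_ℂ‖ ^ 2 = ‖⟪v, u⟫_ℂ‖ ^ 2 +
      (Fintype.card ι + 1) * ‖⟪e j, u⟫_ℂ‖ ^ 2 +
      (if s then 2 else -2) * √(Fintype.card ι + 1) * (⟪u, e j⟫_ℂ * ⟪v, u⟫_ℂ).re := by
  have hc : √(Fintype.card ι + 1 : ℝ) ^ 2 = Fintype.card ι + 1 := Real.sq_sqrt (by positivity)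
  rw [parityVec, inner_add_left, inner_smul_left, Complex.conj_ofReal, ← inner_conj_symm u (e j)]
  simp only [← Complex.normSq_eq_norm_sq, Complex.normSq_apply, Complex.add_re, Complex.add_im,
    Complex.im_ofReal_mul, Complex.mul_re, Complex.conj_re, Complex.conj_im]
  rw [← hc]
  cases s <;> simp <;> ring

/-- The effects other than the remainder add up to n/(n + 1) |v⟩⟨v| + ∑ |e_j⟩⟨e_j|, which is at most
1 by Bessel's inequality. Using n + 1 instead of n avoids division by zero when n = 0. -/
theorem parityEffect_isPositive [CompleteSpace H] {v : H} {e : ι → H} (hv : ‖v‖ = 1)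
    (hve : ∀ j, ⟪v, e j⟫_ℂ = 0) (he : Orthonormal ℂ e) (o : Option (ι × Bool)) :
    (parityEffect v e o).IsPositive := by
  have hsa : ∀ p, IsSelfAdjoint (parityEffect v e (some p)) := fun p => by
    rw [parityEffect, density]
    refine IsSelfAdjoint.smul (Complex.conj_ofReal _) ?_
    exact (InnerProductSpace.isPositive_rankOne_self _).isSelfAdjoint
  have hsa' : IsSelfAdjoint (parityEffect v e o) := by
    cases o with
    | some p => exact hsa p
    | none => exact (IsSelfAdjoint.one _).sub (isSelfAdjoint_sum _ fun p _ => hsa p)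
  refine ⟨hsa'.isSymmetric, fun u => ?_⟩
  rw [ContinuousLinearMap.reApplyInnerSelf_apply]
  rw [← inner_conj_symm, RCLike.conj_re, RCLike.re_eq_complex_re]
  cases o with
  | some p => rw [re_inner_parityEffect_some]; positivity
  | none =>
    have h1 : ⟪u, parityEffect v e none u⟫_ℂ =
        ⟪u, u⟫_ℂ - ∑ p, ⟪u, parityEffect v e (some p) u⟫_ℂ := by
      simp [parityEffect, _root_.sum_apply]
    have hne : (0 : ℝ) < Fintype.card ι + 1 := by positivity
    rw [h1, Complex.sub_re, Complex.re_sum, Fintype.sum_prod_type, sub_nonneg]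
    have h2 (j : ι) : ∑ s : Bool, (⟪u, parityEffect v e (some (j, s)) u⟫_ℂ).re =
        1 / (Fintype.card ι + 1 : ℝ) * ‖⟪v, u⟫_ℂ‖ ^ 2 + ‖⟪e j, u⟫_ℂ‖ ^ 2 := by
      simp only [re_inner_parityEffect_some, Fintype.sum_bool, normSq_inner_parityVec, if_true,
        Bool.false_eq_true, if_false]
      field_simp
      ring
    have h3 : Orthonormal ℂ (fun o : Option ι => o.elim v e) := by
      refine ⟨?_, ?_⟩
      · rintro (_ | j)
        exacts [hv, he.1 j]
      · rintro (_ | i) (_ | j) hij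
        · exact absurd rfl hij
        · exact hve j
        · simp [← inner_conj_symm (e i) v, hve i]
        · exact he.2 fun h => hij (congrArg _ h)
    have h4 := h3.sum_inner_products_le u (s := Finset.univ)
    rw [Fintype.sum_option] at h4
    simp only [Option.elim] at h4
    rw [Finset.sum_congr rfl fun j _ => h2 j, Finset.sum_add_distrib, Finset.sum_const,
      Finset.card_univ, nsmul_eq_mul]
    have h5 : (Fintype.card ι : ℝ) * (1 / (Fintype.card ι + 1) * ‖⟪v, u⟫_ℂ‖ ^ 2) ≤
        ‖⟪v, u⟫_ℂ‖ ^ 2 := by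
      rw [← mul_assoc, mul_one_div]
      refine mul_le_of_le_one_left (by positivity) ?_
      rw [div_le_one hne]
      linarith
    have h6 : (⟪u, u⟫_ℂ).re = ‖u‖ ^ 2 := by rw [inner_self_eq_norm_sq_to_K]; norm_cast
    rw [h6]
    linarith

/-- The statistic with the values `± √(n + 1) a_j` at the outcomes of the parity measurement. -/
def parityStat (a : ι → ℝ) : Option (ι × Bool) → ℝ
  | none => 0
  | some p => (if p.2 then √(Fintype.card ι + 1) else -√(Fintype.card ι + 1)) * a p.1

/-- The signed effects combine to |m⟩⟨v| + |v⟩⟨m| with m = ∑ a_j e_j. This holds at every u, so the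
mean is known near θ₀ and can be differentiated. -/
theorem sum_parityEffect_mul (v : H) (e : ι → H) (a : ι → ℝ) (u : H) :
    ∑ o, (⟪u, parityEffect v e o u⟫_ℂ).re * parityStat a o =
      2 * (⟪u, ∑ j, (a j : ℂ) • e j⟫_ℂ * ⟪v, u⟫_ℂ).re := by
  have hc : √(Fintype.card ι + 1 : ℝ) ^ 2 = Fintype.card ι + 1 := Real.sq_sqrt (by positivity)
  have hne : (Fintype.card ι + 1 : ℝ) ≠ 0 := by positivity
  rw [Fintype.sum_option, Fintype.sum_prod_type, inner_sum, Finset.sum_mul, Complex.re_sum,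
    Finset.mul_sum]
  simp only [parityStat, mul_zero, zero_add, Fintype.sum_bool, re_inner_parityEffect_some,
    normSq_inner_parityVec, if_true, Bool.false_eq_true, if_false]
  refine Finset.sum_congr rfl fun j _ => ?_
  rw [inner_smul_right, mul_assoc (a j : ℂ), Complex.re_ofReal_mul]
  field_simp
  linear_combination (4 * a j * (⟪u, e j⟫_ℂ * ⟪v, u⟫_ℂ).re) * hc

/-- In the state v each outcome (j, ±) has probability 1/(2(n + 1)) and contributes (n + 1) a_j b_j;
the remaining outcome carries the value 0. -/
theorem sum_parityEffect_mul_mul {v : H} {e : ι → H} (hv : ‖v‖ = 1) (hve : ∀ j, ⟪v, e j⟫_ℂ = 0)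
    (a b : ι → ℝ) :
    ∑ o, (⟪v, parityEffect v e o v⟫_ℂ).re * (parityStat a o * parityStat b o) =
      ∑ j, a j * b j := by
  have hc : √(Fintype.card ι + 1 : ℝ) ^ 2 = Fintype.card ι + 1 := Real.sq_sqrt (by positivity)
  have hne : (Fintype.card ι + 1 : ℝ) ≠ 0 := by positivity
  have hev (j) : ⟪e j, v⟫_ℂ = 0 := by rw [← inner_conj_symm, hve, map_zero]
  have hvv : ⟪v, v⟫_ℂ = 1 := by rw [inner_self_eq_norm_sq_to_K, hv]; norm_num
  rw [Fintype.sum_option, Fintype.sum_prod_type]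
  simp only [parityStat, mul_zero, zero_add, Fintype.sum_bool, re_inner_parityEffect_some,
    normSq_inner_parityVec, if_true, Bool.false_eq_true, if_false, hve, hev, hvv, norm_one,
    norm_zero, zero_mul, Complex.zero_re]
  refine Finset.sum_congr rfl fun j _ => ?_
  field_simp
  linear_combination (2 * a j * b j) * hc

end ParityMeasurement

/-! ### Real and Wirtinger coordinates -/

section Coordinates

variable {k : ℕ}

/-- The direction of the real coordinate `α_j` (for `inl j`) or `β_j` (for `inr j`). -/
def coordDir : Fin k ⊕ Fin k → (Fin k → ℂ) :=
  Sum.elim (fun j => Pi.single j 1) (fun j => Pi.single j Complex.I)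

/-- The real coordinate `α_j` (for `inl j`) or `β_j` (for `inr j`). -/
def coord : Fin k ⊕ Fin k → (Fin k → ℂ) → ℝ :=
  Sum.elim (fun j z => (z j).re) (fun j z => (z j).im)

variable (k) in
/-- The matrix of the Wirtinger derivatives in terms of the real partial derivatives. -/
def wirtinger : Matrix (Fin k ⊕ Fin k) (Fin k ⊕ Fin k) ℂ :=
  Matrix.fromBlocks ((1 / 2 : ℂ) • 1) ((1 / 2 : ℂ) • 1) ((-Complex.I / 2) • 1) ((Complex.I / 2) • 1)

variable (k) in
/-- The matrix of the conjugate extension `(θ, θ^*)` in terms of the real coordinates. -/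
def conjCoord : Matrix (Fin k ⊕ Fin k) (Fin k ⊕ Fin k) ℂ :=
  Matrix.fromBlocks 1 (Complex.I • 1) 1 ((-Complex.I) • 1)

theorem conjCoord_mul_wirtinger : conjCoord k * wirtinger k = 1 := by
  rw [conjCoord, wirtinger, Matrix.fromBlocks_multiply, ← Matrix.fromBlocks_one]
  have h : -Complex.I / 2 * Complex.I = 1 / 2 := by
    linear_combination (-1 / 2 : ℂ) * Complex.I_mul_I
  have h' : Complex.I / 2 * Complex.I = -1 / 2 := by
    linear_combination (1 / 2 : ℂ) * Complex.I_mul_I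
  congr 1 <;> simp only [Matrix.smul_mul, Matrix.mul_smul, Matrix.one_mul, smul_smul, ← add_smul,
    mul_neg, h, h'] <;> norm_num

theorem wirtinger_mul_conjCoord : wirtinger k * conjCoord k = 1 :=
  mul_eq_one_comm.1 conjCoord_mul_wirtinger

theorem sum_wirtinger_inl {E : Type*} [AddCommGroup E] [Module ℂ E] (D : Fin k ⊕ Fin k → E)
    (j : Fin k) : ∑ x, wirtinger k x (Sum.inl j) • D x =
      (1 / 2 : ℂ) • (D (Sum.inl j) - Complex.I • D (Sum.inr j)) := by
  simp only [Fintype.sum_sum_type, wirtinger, Matrix.fromBlocks_apply₁₁, Matrix.fromBlocks_apply₂₁,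
    Matrix.smul_apply, Matrix.one_apply, smul_eq_mul, mul_ite, mul_one, mul_zero, ite_smul,
    zero_smul, Finset.sum_ite_eq', Finset.mem_univ, if_true]
  module

theorem sum_wirtinger_inr {E : Type*} [AddCommGroup E] [Module ℂ E] (D : Fin k ⊕ Fin k → E)
    (j : Fin k) : ∑ x, wirtinger k x (Sum.inr j) • D x =
      (1 / 2 : ℂ) • (D (Sum.inl j) + Complex.I • D (Sum.inr j)) := by
  simp only [Fintype.sum_sum_type, wirtinger, Matrix.fromBlocks_apply₁₂, Matrix.fromBlocks_apply₂₂,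
    Matrix.smul_apply, Matrix.one_apply, smul_eq_mul, mul_ite, mul_one, mul_zero, ite_smul,
    zero_smul, Finset.sum_ite_eq', Finset.mem_univ, if_true]
  module

theorem dhat_eq_sum {E : Type*} [NormedAddCommGroup E] [NormedSpace ℂ E] (F : (Fin k → ℂ) → E)
    (θ₀ : Fin k → ℂ) (a : Fin k ⊕ Fin k) :
    dhat F θ₀ a = ∑ x, wirtinger k x a • lineDeriv ℝ F θ₀ (coordDir x) := by
  rcases a with j | j
  · rw [sum_wirtinger_inl (fun x => lineDeriv ℝ F θ₀ (coordDir x))]; rfl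
  · rw [sum_wirtinger_inr (fun x => lineDeriv ℝ F θ₀ (coordDir x))]; rfl

theorem conj_wirtinger (x a : Fin k ⊕ Fin k) :
    conj (wirtinger k x a) = wirtinger k x a.swap := by
  rcases a with a | a <;> rcases x with x | x <;>
    simp [wirtinger, Matrix.one_apply, apply_ite (starRingEnd ℂ), Complex.conj_ofNat]

theorem sum_conjCoord (z : Fin k → ℂ) (a : Fin k ⊕ Fin k) :
    ∑ x, conjCoord k a x * (coord x z : ℂ) = Sum.elim z (fun i => conj (z i)) a := by
  rcases a with j | j <;>
  simp [Fintype.sum_sum_type, conjCoord, coord, Matrix.one_apply]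
  · rw [mul_comm, Complex.re_add_im]
  · apply Complex.ext <;> simp

theorem hasPartials_iff {E : Type*} [NormedAddCommGroup E] [NormedSpace ℂ E]
    {F : (Fin k → ℂ) → E} {θ₀ : Fin k → ℂ} :
    HasPartials F θ₀ ↔ ∀ x, LineDifferentiableAt ℝ F θ₀ (coordDir x) :=
  ⟨fun h x => x.casesOn (fun j => (h j).1) (fun j => (h j).2),
    fun h j => ⟨h (Sum.inl j), h (Sum.inr j)⟩⟩

theorem coord_coordDir (x y : Fin k ⊕ Fin k) : coord x (coordDir y) = if x = y then 1 else 0 := by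
  rcases x with x | x <;> rcases y with y | y <;>
    simp [coord, coordDir, Pi.single_apply, apply_ite Complex.re, apply_ite Complex.im]

theorem coord_ext {z w : Fin k → ℂ} (h : ∀ x, coord x z = coord x w) : z = w :=
  funext fun j => Complex.ext (h (Sum.inl j)) (h (Sum.inr j))

/-- The lower blocks are conjugates of the upper ones, and the upper ones determine the two real
partial derivatives of each component linearly. -/
theorem jacobianHat_eq_one_iff {g : (Fin k → ℂ) → (Fin k → ℂ)} {θ₀ : Fin k → ℂ} :
    jacobianHat g θ₀ = 1 ↔
      ∀ y i, lineDeriv ℝ (fun θ => g θ i) θ₀ (coordDir y) = coordDir y i := by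
  have key (i j : Fin k) : (dz (fun θ => g θ i) θ₀ j = (1 : Matrix (Fin k) (Fin k) ℂ) i j ∧
      dzbar (fun θ => g θ i) θ₀ j = 0) ↔
      (lineDeriv ℝ (fun θ => g θ i) θ₀ (coordDir (Sum.inl j)) = coordDir (Sum.inl j) i ∧
      lineDeriv ℝ (fun θ => g θ i) θ₀ (coordDir (Sum.inr j)) = coordDir (Sum.inr j) i) := by
    have h1 : (coordDir (Sum.inl j) : Fin k → ℂ) i = (1 : Matrix (Fin k) (Fin k) ℂ) i j := by
      simp [coordDir, Pi.single_apply, Matrix.one_apply]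
    have h2 : (coordDir (Sum.inr j) : Fin k → ℂ) i =
        Complex.I * (1 : Matrix (Fin k) (Fin k) ℂ) i j := by
      simp [coordDir, Pi.single_apply, Matrix.one_apply]
    rw [h1, h2, dz, dzbar, smul_eq_mul, smul_eq_mul]
    change (1 / 2 * (lineDeriv ℝ (fun θ => g θ i) θ₀ (coordDir (Sum.inl j)) -
      Complex.I * lineDeriv ℝ (fun θ => g θ i) θ₀ (coordDir (Sum.inr j))) = _ ∧
      1 / 2 * (lineDeriv ℝ (fun θ => g θ i) θ₀ (coordDir (Sum.inl j)) +
      Complex.I * lineDeriv ℝ (fun θ => g θ i) θ₀ (coordDir (Sum.inr j))) = 0) ↔ _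
    generalize lineDeriv ℝ (fun θ => g θ i) θ₀ (coordDir (Sum.inl j)) = p
    generalize lineDeriv ℝ (fun θ => g θ i) θ₀ (coordDir (Sum.inr j)) = q
    constructor
    · rintro ⟨h3, h4⟩
      exact ⟨by linear_combination h3 + h4,
        by linear_combination Complex.I * h3 - Complex.I * h4 + q * Complex.I_mul_I⟩
    · rintro ⟨h3, h4⟩
      rw [h3, h4]
      constructor
      · linear_combination (-1 / 2) * (1 : Matrix (Fin k) (Fin k) ℂ) i j * Complex.I_mul_I
      · linear_combination (1 / 2) * (1 : Matrix (Fin k) (Fin k) ℂ) i j * Complex.I_mul_I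
  rw [jacobianHat, ← Matrix.fromBlocks_one, Matrix.fromBlocks_inj]
  constructor
  · rintro ⟨h1, h2, -, -⟩ (j | j) i
    · exact ((key i j).1 ⟨congrFun (congrFun h1 i) j, congrFun (congrFun h2 i) j⟩).1
    · exact ((key i j).1 ⟨congrFun (congrFun h1 i) j, congrFun (congrFun h2 i) j⟩).2
  · intro h
    have h' i j := (key i j).2 ⟨h (Sum.inl j) i, h (Sum.inr j) i⟩
    refine ⟨?_, ?_, ?_, ?_⟩ <;> ext i j <;>
      simp [(h' i j).1, (h' i j).2, Matrix.one_apply, apply_ite (starRingEnd ℂ)]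

end Coordinates

/-! ### Horizontal tangent vectors of a family of pure states -/

section Horizontal

variable {H : Type*} [NormedAddCommGroup H] [InnerProductSpace ℂ H] {k : ℕ}

/-- The horizontal vector `2 (∂ψ - ⟨ψ, ∂ψ⟩ ψ)` of the real coordinate `x`. -/
def horizontal (ψ : (Fin k → ℂ) → H) (θ₀ : Fin k → ℂ) (x : Fin k ⊕ Fin k) : H :=
  (2 : ℂ) • (lineDeriv ℝ ψ θ₀ (coordDir x) -
    ⟪ψ θ₀, lineDeriv ℝ ψ θ₀ (coordDir x)⟫_ℂ • ψ θ₀)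

theorem inner_self_of_norm_one {v : H} (hv : ‖v‖ = 1) : ⟪v, v⟫_ℂ = 1 := by
  rw [inner_self_eq_norm_sq_to_K, hv]; norm_num

theorem inner_horizontal {ψ : (Fin k → ℂ) → H} {θ₀ : Fin k → ℂ} (hv : ‖ψ θ₀‖ = 1)
    (x : Fin k ⊕ Fin k) : ⟪ψ θ₀, horizontal ψ θ₀ x⟫_ℂ = 0 := by
  rw [horizontal, inner_smul_right, inner_sub_right, inner_smul_right, inner_self_of_norm_one hv,
    mul_one, sub_self, mul_zero]

theorem inner_horizontal_left {ψ : (Fin k → ℂ) → H} {θ₀ : Fin k → ℂ} {w : H}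
    (hw : ⟪ψ θ₀, w⟫_ℂ = 0) (x : Fin k ⊕ Fin k) :
    ⟪horizontal ψ θ₀ x, w⟫_ℂ = 2 * ⟪lineDeriv ℝ ψ θ₀ (coordDir x), w⟫_ℂ := by
  rw [horizontal, inner_smul_left, inner_sub_left, inner_smul_left, hw, mul_zero, sub_zero,
    Complex.conj_ofNat]

theorem eventually_line {Θ : Set (Fin k → ℂ)} (hΘ : IsOpen Θ) {θ₀ : Fin k → ℂ} (hθ₀ : θ₀ ∈ Θ)
    (v : Fin k → ℂ) : ∀ᶠ r : ℝ in 𝓝 0, θ₀ + r • v ∈ Θ := by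
  have h : Tendsto (fun r : ℝ => θ₀ + r • v) (𝓝 0) (𝓝 θ₀) := by
    have : Continuous fun r : ℝ => θ₀ + r • v := by fun_prop
    simpa using this.tendsto 0
  exact h (hΘ.mem_nhds hθ₀)

theorem re_inner_deriv_eq_zero {γ : ℝ → H} {d : H} (hγ : HasDerivAt γ d 0)
    (h : ∀ᶠ r in 𝓝 (0 : ℝ), ‖γ r‖ = 1) : (⟪γ 0, d⟫_ℂ).re = 0 := by
  have h1 : HasDerivAt (fun r => ⟪γ r, γ r⟫_ℂ) (⟪γ 0, d⟫_ℂ + ⟪d, γ 0⟫_ℂ) 0 := hγ.inner ℂ hγ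
  have h2 : HasDerivAt (fun r => ⟪γ r, γ r⟫_ℂ) 0 0 :=
    (hasDerivAt_const (0 : ℝ) (1 : ℂ)).congr_of_eventuallyEq
      (h.mono fun r hr => inner_self_of_norm_one hr)
  have h3 := congrArg Complex.re (h1.unique h2)
  rw [← inner_conj_symm d, Complex.add_re, Complex.conj_re, Complex.zero_re] at h3
  linarith

theorem hasDerivAt_density {γ : ℝ → H} {d : H} (hγ : HasDerivAt γ d 0) :
    HasDerivAt (fun r => density (γ r))
      (InnerProductSpace.rankOne ℂ d (γ 0) + InnerProductSpace.rankOne ℂ (γ 0) d) 0 := by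
  -- Bilinear over ℝ only: `rankOne` is conjugate linear in its second argument.
  have hb : IsBoundedBilinearMap ℝ fun p : H × H => InnerProductSpace.rankOne ℂ p.1 p.2 := by
    refine ⟨fun x x' y => by simp, fun c x y => ?_, fun x y y' => by simp, fun c x y => ?_,
      1, one_pos, fun x y => by simp⟩
    · ext z
      simp only [InnerProductSpace.rankOne_apply, _root_.smul_apply]
      exact smul_comm _ _ _
    · ext z
      simp only [InnerProductSpace.rankOne_apply, RCLike.real_smul_eq_coe_smul (K := ℂ),
        inner_smul_left, _root_.smul_apply, RCLike.conj_ofReal, mul_smul]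
  have h := (hb.hasFDerivAt (γ 0, γ 0)).comp_hasDerivAt (0 : ℝ) (hγ.prodMk hγ)
  rw [add_comm]
  exact h

variable {Θ : Set (Fin k → ℂ)} {ψ : (Fin k → ℂ) → H} {θ₀ : Fin k → ℂ}

theorem hasDerivAt_line {E : Type*} [NormedAddCommGroup E] [NormedSpace ℂ E]
    {F : (Fin k → ℂ) → E} (hdiff : HasPartials F θ₀) (x : Fin k ⊕ Fin k) :
    HasDerivAt (fun r : ℝ => F (θ₀ + r • coordDir x)) (lineDeriv ℝ F θ₀ (coordDir x)) 0 :=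
  (hasPartials_iff.1 hdiff x).hasLineDerivAt

/-- Here ∂ρ = |∂ψ⟩⟨ψ| + |ψ⟩⟨∂ψ|, and normalization makes ⟨ψ, ∂ψ⟩ imaginary, so ρ' acts on ψ from
either side by the horizontal part of ∂ψ. The Wirtinger coefficients are the same on both sides,
without conjugation, since they multiply the whole operator. -/
theorem dhat_density_apply (hΘ : IsOpen Θ) (hψ : ∀ θ ∈ Θ, ‖ψ θ‖ = 1) (hθ₀ : θ₀ ∈ Θ)
    (hdiff : HasPartials ψ θ₀) (a : Fin k ⊕ Fin k) :
    (2 : ℂ) • dhat (fun θ => density (ψ θ)) θ₀ a (ψ θ₀) =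
      ∑ x, wirtinger k x a • horizontal ψ θ₀ x ∧
    ∀ u, 2 * ⟪ψ θ₀, dhat (fun θ => density (ψ θ)) θ₀ a u⟫_ℂ =
      ∑ x, wirtinger k x a * ⟪horizontal ψ θ₀ x, u⟫_ℂ := by
  have hv := inner_self_of_norm_one (hψ θ₀ hθ₀)
  set D : Fin k ⊕ Fin k → H := fun x => lineDeriv ℝ ψ θ₀ (coordDir x) with hD
  have h1 (x : Fin k ⊕ Fin k) : lineDeriv ℝ (fun θ => density (ψ θ)) θ₀ (coordDir x) =
      InnerProductSpace.rankOne ℂ (D x) (ψ θ₀) + InnerProductSpace.rankOne ℂ (ψ θ₀) (D x) := by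
    have h := hasDerivAt_density (hasDerivAt_line hdiff x)
    simp only [zero_smul, add_zero] at h
    exact HasLineDerivAt.lineDeriv h
  have h2 (x : Fin k ⊕ Fin k) : ⟪D x, ψ θ₀⟫_ℂ = -⟪ψ θ₀, D x⟫_ℂ := by
    have h := re_inner_deriv_eq_zero (hasDerivAt_line hdiff x)
      ((eventually_line hΘ hθ₀ (coordDir x)).mono fun r hr => hψ _ hr)
    simp only [zero_smul, add_zero] at h
    change (⟪ψ θ₀, D x⟫_ℂ).re = 0 at h
    rw [← inner_conj_symm (D x)]
    apply Complex.ext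
    · rw [Complex.conj_re, Complex.neg_re, h, neg_zero]
    · rw [Complex.conj_im, Complex.neg_im]
  rw [dhat_eq_sum]
  constructor
  · rw [_root_.sum_apply, Finset.smul_sum]
    refine Finset.sum_congr rfl fun x _ => ?_
    rw [_root_.smul_apply, h1, _root_.add_apply, InnerProductSpace.rankOne_apply,
      InnerProductSpace.rankOne_apply, hv, h2, horizontal, smul_comm]
    congr 2
    module
  · intro u
    rw [_root_.sum_apply, inner_sum, Finset.mul_sum]
    refine Finset.sum_congr rfl fun x _ => ?_
    rw [_root_.smul_apply, h1, _root_.add_apply, InnerProductSpace.rankOne_apply,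
      InnerProductSpace.rankOne_apply, inner_smul_right, inner_add_right, inner_smul_right,
      inner_smul_right, hv, horizontal, inner_smul_left, inner_sub_left, inner_smul_left,
      inner_conj_symm, h2]
    simp only [map_ofNat]
    ring

/-- Complex symmetric logarithmic derivatives of a pure state act on the state vector, from the
left and from the right, by the horizontal tangent vectors. -/
theorem IsComplexSLD.apply_eq (hΘ : IsOpen Θ) (hψ : ∀ θ ∈ Θ, ‖ψ θ‖ = 1) (hθ₀ : θ₀ ∈ Θ)
    (hdiff : HasPartials ψ θ₀) {L : Fin k ⊕ Fin k → H →L[ℂ] H} (hL : IsComplexSLD ψ θ₀ L)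
    (a : Fin k ⊕ Fin k) :
    L a (ψ θ₀) = ∑ x, wirtinger k x a • horizontal ψ θ₀ x ∧
    ∀ u, ⟪ψ θ₀, L a u⟫_ℂ = ∑ x, wirtinger k x a * ⟪horizontal ψ θ₀ x, u⟫_ℂ := by
  have hv := inner_self_of_norm_one (hψ θ₀ hθ₀)
  obtain ⟨h1, h2⟩ := dhat_density_apply hΘ hψ hθ₀ hdiff a
  rw [hL a] at h1 h2
  have e (u : H) : ((1 / 2 : ℂ) • (density (ψ θ₀) * L a + L a * density (ψ θ₀))) u =
      (1 / 2 : ℂ) • (⟪ψ θ₀, L a u⟫_ℂ • ψ θ₀ + ⟪ψ θ₀, u⟫_ℂ • L a (ψ θ₀)) := by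
    simp [density]
  simp only [e] at h1 h2
  have h3 := h2 (ψ θ₀)
  have hz : ∑ x, wirtinger k x a * ⟪horizontal ψ θ₀ x, ψ θ₀⟫_ℂ = 0 := by
    refine Finset.sum_eq_zero fun x _ => ?_
    rw [← inner_conj_symm, inner_horizontal (hψ θ₀ hθ₀), map_zero, mul_zero]
  rw [hz, inner_smul_right, inner_add_right, inner_smul_right, inner_smul_right, hv] at h3
  -- Sandwiching the defining equation between ψ(θ₀) removes the mean of L_a; self-adjointness is
  -- not needed.
  have h4 : ⟪ψ θ₀, L a (ψ θ₀)⟫_ℂ = 0 := by linear_combination (1 / 2) * h3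
  constructor
  · rw [← h1, h4, hv, smul_smul]
    module
  · intro u
    rw [← h2 u, inner_smul_right, inner_add_right, inner_smul_right, inner_smul_right, hv, h4]
    ring

/-- The complex Gram matrix of the horizontal tangent vectors. -/
def horizontalGram (ψ : (Fin k → ℂ) → H) (θ₀ : Fin k → ℂ) :
    Matrix (Fin k ⊕ Fin k) (Fin k ⊕ Fin k) ℂ :=
  Matrix.of fun x y => ⟪horizontal ψ θ₀ x, horizontal ψ θ₀ y⟫_ℂ

/-- The quantum Fisher information matrix in the real coordinates. -/
def realFisher (ψ : (Fin k → ℂ) → H) (θ₀ : Fin k → ℂ) :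
    Matrix (Fin k ⊕ Fin k) (Fin k ⊕ Fin k) ℝ :=
  Matrix.of fun x y => (⟪horizontal ψ θ₀ x, horizontal ψ θ₀ y⟫_ℂ).re

/-- L_a acts to the left on the bra and L_b to the right on the ket, so the value does not depend on
the choice of the logarithmic derivatives. -/
theorem IsComplexSLD.expval_mul (hΘ : IsOpen Θ) (hψ : ∀ θ ∈ Θ, ‖ψ θ‖ = 1) (hθ₀ : θ₀ ∈ Θ)
    (hdiff : HasPartials ψ θ₀) {L : Fin k ⊕ Fin k → H →L[ℂ] H} (hL : IsComplexSLD ψ θ₀ L)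
    (a b : Fin k ⊕ Fin k) :
    ⟪ψ θ₀, L a (L b (ψ θ₀))⟫_ℂ =
      ((wirtinger k).transpose * horizontalGram ψ θ₀ * wirtinger k) a b := by
  rw [(hL.apply_eq hΘ hψ hθ₀ hdiff a).2, (hL.apply_eq hΘ hψ hθ₀ hdiff b).1, Matrix.mul_assoc]
  simp only [Matrix.mul_apply, Matrix.transpose_apply, inner_sum, inner_smul_right,
    horizontalGram, Matrix.of_apply]
  simp only [mul_comm]

theorem horizontalGram_transpose (x y : Fin k ⊕ Fin k) :
    horizontalGram ψ θ₀ y x = conj (horizontalGram ψ θ₀ x y) := (inner_conj_symm _ _).symm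

theorem horizontalGram_add_transpose : horizontalGram ψ θ₀ + (horizontalGram ψ θ₀).transpose =
    (2 : ℂ) • (realFisher ψ θ₀).map Complex.ofReal := by
  ext x y
  rw [Matrix.add_apply, Matrix.transpose_apply, horizontalGram_transpose x y, Complex.add_conj]
  simp [realFisher, horizontalGram]

/-- Row a of the information matrix carries the derivative along the conjugate of a; this turns the
transpose into an adjoint. -/
theorem transpose_wirtinger_swap (A : Matrix (Fin k ⊕ Fin k) (Fin k ⊕ Fin k) ℂ)
    (a b : Fin k ⊕ Fin k) : ((wirtinger k).transpose * A * wirtinger k) a.swap b =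
      ((wirtinger k).conjTranspose * A * wirtinger k) a b := by
  rw [Matrix.mul_assoc, Matrix.mul_assoc, Matrix.mul_apply, Matrix.mul_apply]
  refine Finset.sum_congr rfl fun x _ => ?_
  rw [Matrix.transpose_apply, Matrix.conjTranspose_apply, ← conj_wirtinger]
  rfl

/-- The anticommutator replaces the Gram matrix G by (G + Gᵀ)/2 = Re G. -/
theorem IsComplexSLD.sqfim_eq (hΘ : IsOpen Θ) (hψ : ∀ θ ∈ Θ, ‖ψ θ‖ = 1) (hθ₀ : θ₀ ∈ Θ)
    (hdiff : HasPartials ψ θ₀) {L : Fin k ⊕ Fin k → H →L[ℂ] H} (hL : IsComplexSLD ψ θ₀ L) :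
    sqfim (ψ θ₀) L = (wirtinger k).conjTranspose * (realFisher ψ θ₀).map Complex.ofReal *
      wirtinger k := by
  set S := (wirtinger k).conjTranspose * (realFisher ψ θ₀).map Complex.ofReal * wirtinger k with hS
  have h1 (a b : Fin k ⊕ Fin k) :
      (1 / 2 : ℂ) * expval (ψ θ₀) (L a.swap * L b + L b * L a.swap) = S a b := by
    have e : expval (ψ θ₀) (L a.swap * L b + L b * L a.swap) =
        ⟪ψ θ₀, L a.swap (L b (ψ θ₀))⟫_ℂ + ⟪ψ θ₀, L b (L a.swap (ψ θ₀))⟫_ℂ := by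
      rw [expval, _root_.add_apply, inner_add_right]; rfl
    have ht : ((wirtinger k).transpose * horizontalGram ψ θ₀ * wirtinger k) b a.swap =
        ((wirtinger k).transpose * (horizontalGram ψ θ₀).transpose * wirtinger k) a.swap b := by
      conv_rhs => rw [← Matrix.transpose_apply (_ * _) b a.swap]
      simp only [Matrix.transpose_mul, Matrix.transpose_transpose, Matrix.mul_assoc]
    rw [e, hL.expval_mul hΘ hψ hθ₀ hdiff, hL.expval_mul hΘ hψ hθ₀ hdiff, ht, ← Matrix.add_apply,
      ← Matrix.add_mul, ← Matrix.mul_add, horizontalGram_add_transpose, transpose_wirtinger_swap,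
      Matrix.mul_smul, Matrix.smul_mul, Matrix.smul_apply, smul_eq_mul, ← mul_assoc]
    norm_num
    rfl
  -- The lower blocks are defined as conjugates of the upper ones; reality of F makes the right-hand
  -- side do the same.
  have h2 (a b : Fin k ⊕ Fin k) : conj (S a b) = S a.swap b.swap := by
    simp only [hS, Matrix.mul_apply, Matrix.conjTranspose_apply, Matrix.map_apply, map_sum,
      map_mul, Complex.conj_ofReal, ← conj_wirtinger]
    rfl
  ext a b
  rcases a with a | a <;> rcases b with b | b
  · exact h1 (Sum.inl a) (Sum.inl b)
  · exact h1 (Sum.inl a) (Sum.inr b)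
  · exact (congrArg conj (h1 (Sum.inl a) (Sum.inr b))).trans (h2 _ _)
  · exact (congrArg conj (h1 (Sum.inl a) (Sum.inl b))).trans (h2 _ _)

/-- The commutator retains G − Gᵀ = 2i Im G, and multiplication by the invertible Wirtinger matrix
on both sides loses nothing. -/
theorem IsComplexSLD.commutator_eq_zero_iff (hΘ : IsOpen Θ) (hψ : ∀ θ ∈ Θ, ‖ψ θ‖ = 1)
    (hθ₀ : θ₀ ∈ Θ) (hdiff : HasPartials ψ θ₀) {L : Fin k ⊕ Fin k → H →L[ℂ] H}
    (hL : IsComplexSLD ψ θ₀ L) :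
    (∀ a b, ⟪ψ θ₀, (L a * L b - L b * L a) (ψ θ₀)⟫_ℂ = 0) ↔
      ∀ x y, (⟪horizontal ψ θ₀ x, horizontal ψ θ₀ y⟫_ℂ).im = 0 := by
  set A := horizontalGram ψ θ₀ - (horizontalGram ψ θ₀).transpose with hA
  have h1 (a b : Fin k ⊕ Fin k) : ⟪ψ θ₀, (L a * L b - L b * L a) (ψ θ₀)⟫_ℂ =
      ((wirtinger k).transpose * A * wirtinger k) a b := by
    have e : ⟪ψ θ₀, (L a * L b - L b * L a) (ψ θ₀)⟫_ℂ =
        ⟪ψ θ₀, L a (L b (ψ θ₀))⟫_ℂ - ⟪ψ θ₀, L b (L a (ψ θ₀))⟫_ℂ := by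
      rw [_root_.sub_apply, inner_sub_right]; rfl
    have ht : ((wirtinger k).transpose * horizontalGram ψ θ₀ * wirtinger k) b a =
        ((wirtinger k).transpose * (horizontalGram ψ θ₀).transpose * wirtinger k) a b := by
      conv_rhs => rw [← Matrix.transpose_apply (_ * _) b a]
      simp only [Matrix.transpose_mul, Matrix.transpose_transpose, Matrix.mul_assoc]
    rw [e, hL.expval_mul hΘ hψ hθ₀ hdiff, hL.expval_mul hΘ hψ hθ₀ hdiff, ht, ← Matrix.sub_apply,
      ← Matrix.sub_mul, ← Matrix.mul_sub]
  have h2 : (∀ a b, ((wirtinger k).transpose * A * wirtinger k) a b = 0) ↔ A = 0 := by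
    constructor
    · intro h
      have h0 : (wirtinger k).transpose * A * wirtinger k = 0 := Matrix.ext h
      have ht : (conjCoord k).transpose * (wirtinger k).transpose = 1 := by
        rw [← Matrix.transpose_mul, wirtinger_mul_conjCoord, Matrix.transpose_one]
      calc A = ((conjCoord k).transpose * (wirtinger k).transpose) * A *
            (wirtinger k * conjCoord k) := by
              rw [ht, wirtinger_mul_conjCoord, Matrix.one_mul, Matrix.mul_one]
        _ = (conjCoord k).transpose * ((wirtinger k).transpose * A * wirtinger k) *
            conjCoord k := by simp only [Matrix.mul_assoc]
        _ = 0 := by rw [h0, Matrix.mul_zero, Matrix.zero_mul]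
    · intro h
      simp [h]
  simp only [h1]
  rw [h2, ← Matrix.ext_iff]
  refine forall_congr' fun x => forall_congr' fun y => ?_
  rw [hA, Matrix.sub_apply, Matrix.transpose_apply, horizontalGram_transpose x y, Complex.sub_conj]
  simp [horizontalGram]

end Horizontal

/-! ### The covariance in real coordinates -/

section Covariance

variable {Ω : Type*} [MeasurableSpace Ω] {k : ℕ}

/-- The real coordinate `x` of the error `t - θ₀`. -/
def coordError (t : Ω → (Fin k → ℂ)) (θ₀ : Fin k → ℂ) (x : Fin k ⊕ Fin k) (ω : Ω) : ℝ :=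
  coord x (t ω) - coord x θ₀

/-- The matrix of the second moments of the real coordinates of `t - θ₀`. -/
def realCov (P : Measure Ω) (t : Ω → (Fin k → ℂ)) (θ₀ : Fin k → ℂ) :
    Matrix (Fin k ⊕ Fin k) (Fin k ⊕ Fin k) ℝ :=
  Matrix.of fun x y => ∫ ω, coordError t θ₀ x ω * coordError t θ₀ y ω ∂P

theorem measurable_coordError {t : Ω → (Fin k → ℂ)} (ht : Measurable t) (θ₀ : Fin k → ℂ)
    (x : Fin k ⊕ Fin k) : Measurable (coordError t θ₀ x) := by
  have h (j : Fin k) : Measurable fun ω => t ω j := (measurable_pi_apply j).comp ht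
  rcases x with j | j
  · exact (Complex.measurable_re.comp (h j)).sub_const _
  · exact (Complex.measurable_im.comp (h j)).sub_const _

theorem memLp_coordError {P : Measure Ω} [IsFiniteMeasure P] {t : Ω → (Fin k → ℂ)}
    (h : ∀ i, MemLp (fun ω => t ω i) 2 P) (θ₀ : Fin k → ℂ) (x : Fin k ⊕ Fin k) :
    MemLp (coordError t θ₀ x) 2 P := by
  rcases x with j | j
  · exact (h j).re.sub (memLp_const _)
  · exact (h j).im.sub (memLp_const _)

theorem integral_coordError {P : Measure Ω} [IsProbabilityMeasure P] {t : Ω → (Fin k → ℂ)}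
    (h : ∀ i, MemLp (fun ω => t ω i) 2 P) (θ₀ : Fin k → ℂ) (x : Fin k ⊕ Fin k) :
    ∫ ω, coordError t θ₀ x ω ∂P = coord x (mean P t) - coord x θ₀ := by
  have hi (i) : Integrable (fun ω => t ω i) P := (h i).integrable one_le_two
  rcases x with j | j
  · simp only [coordError, coord, Sum.elim_inl, mean]
    refine (integral_sub (hi j).re (integrable_const _)).trans ?_
    rw [integral_const, probReal_univ, one_smul]
    exact congrArg (· - _) (integral_re (hi j))
  · simp only [coordError, coord, Sum.elim_inr, mean]
    refine (integral_sub (hi j).im (integrable_const _)).trans ?_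
    rw [integral_const, probReal_univ, one_smul]
    exact congrArg (· - _) (integral_im (hi j))

theorem covHat_eq {P : Measure Ω} [IsProbabilityMeasure P] {t : Ω → (Fin k → ℂ)}
    {θ₀ : Fin k → ℂ} (h : ∀ i, MemLp (fun ω => t ω i) 2 P) (hmean : mean P t = θ₀) :
    covHat P t = conjCoord k * (realCov P t θ₀).map Complex.ofReal *
      (conjCoord k).conjTranspose := by
  have h1 (a : Fin k ⊕ Fin k) (ω : Ω) : conjExt t ω a - ∫ ω', conjExt t ω' a ∂P =
      ∑ x, conjCoord k a x * (coordError t θ₀ x ω : ℂ) := by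
    have e1 : conjExt t ω a = ∑ x, conjCoord k a x * (coord x (t ω) : ℂ) :=
      (sum_conjCoord (t ω) a).symm
    have e2 : ∫ ω', conjExt t ω' a ∂P = ∑ x, conjCoord k a x * (coord x θ₀ : ℂ) := by
      rw [sum_conjCoord, ← hmean]
      rcases a with j | j
      · rfl
      · exact integral_conj
    rw [e1, e2, ← Finset.sum_sub_distrib]
    refine Finset.sum_congr rfl fun x _ => ?_
    rw [coordError, Complex.ofReal_sub, mul_sub]
  have hs := memLp_coordError h θ₀
  have hint (x y : Fin k ⊕ Fin k) :
      Integrable (fun ω => coordError t θ₀ x ω * coordError t θ₀ y ω) P :=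
    (hs x).integrable_mul (hs y)
  ext a b
  simp only [covHat, Matrix.of_apply, h1]
  have h2 (ω : Ω) : (∑ x, conjCoord k a x * (coordError t θ₀ x ω : ℂ)) *
      conj (∑ x, conjCoord k b x * (coordError t θ₀ x ω : ℂ)) =
      ∑ y, ∑ x, conjCoord k a x * conj (conjCoord k b y) *
        ((coordError t θ₀ x ω * coordError t θ₀ y ω : ℝ) : ℂ) := by
    rw [map_sum, Finset.sum_mul_sum, Finset.sum_comm]
    refine Finset.sum_congr rfl fun y _ => Finset.sum_congr rfl fun x _ => ?_
    rw [map_mul, Complex.conj_ofReal, Complex.ofReal_mul]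
    ring
  simp only [h2]
  have hint' (x y : Fin k ⊕ Fin k) (c : ℂ) : Integrable (fun ω =>
      c * ((coordError t θ₀ x ω * coordError t θ₀ y ω : ℝ) : ℂ)) P :=
    ((hint x y).ofReal (𝕜 := ℂ)).const_mul c
  refine (integral_finsetSum _ fun y _ => integrable_finsetSum _ fun x _ => hint' x y _).trans ?_
  simp only [Matrix.mul_apply, Matrix.conjTranspose_apply, Matrix.map_apply]
  refine Finset.sum_congr rfl fun y _ => ?_
  refine (integral_finsetSum _ fun x _ => hint' x y _).trans ?_
  rw [Finset.sum_mul]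
  refine Finset.sum_congr rfl fun x _ => ?_
  rw [integral_const_mul]
  have h3 : ∫ ω, ((coordError t θ₀ x ω * coordError t θ₀ y ω : ℝ) : ℂ) ∂P =
    (realCov P t θ₀ x y : ℂ) := integral_ofReal
  rw [h3, RCLike.star_def]
  ring

/-- With V and W the mutually inverse coordinate matrices, (VCV†)(W†FW) = V(CF)W. -/
theorem conj_mul_eq_inv_iff {C F : Matrix (Fin k ⊕ Fin k) (Fin k ⊕ Fin k) ℝ}
    {S : Matrix (Fin k ⊕ Fin k) (Fin k ⊕ Fin k) ℂ} (hS : IsUnit S)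
    (h : S = (wirtinger k).conjTranspose * F.map Complex.ofReal * wirtinger k) :
    conjCoord k * C.map Complex.ofReal * (conjCoord k).conjTranspose = S⁻¹ ↔ C * F = 1 := by
  have hUV : (conjCoord k).conjTranspose * (wirtinger k).conjTranspose = 1 := by
    rw [← Matrix.conjTranspose_mul, wirtinger_mul_conjCoord, Matrix.conjTranspose_one]
  have h1 : conjCoord k * C.map Complex.ofReal * (conjCoord k).conjTranspose * S =
      conjCoord k * (C.map Complex.ofReal * F.map Complex.ofReal) * wirtinger k := by
    calc _ = conjCoord k * C.map Complex.ofReal * ((conjCoord k).conjTranspose *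
        (wirtinger k).conjTranspose) * F.map Complex.ofReal * wirtinger k := by
          rw [h]; simp only [Matrix.mul_assoc]
      _ = _ := by rw [hUV, Matrix.mul_one]; simp only [Matrix.mul_assoc]
  have hCF : C.map Complex.ofReal * F.map Complex.ofReal = (C * F).map Complex.ofReal :=
    (Matrix.map_mul (f := Complex.ofRealHom)).symm
  have hdet := (Matrix.isUnit_iff_isUnit_det S).1 hS
  constructor
  · intro h2
    rw [h2, Matrix.nonsing_inv_mul S hdet] at h1
    have h3 : (C * F).map Complex.ofReal = 1 := by
      calc _ = (wirtinger k * conjCoord k) * (C.map Complex.ofReal * F.map Complex.ofReal) *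
          (wirtinger k * conjCoord k) := by
            rw [wirtinger_mul_conjCoord, Matrix.one_mul, Matrix.mul_one, hCF]
        _ = wirtinger k * (conjCoord k * (C.map Complex.ofReal * F.map Complex.ofReal) *
            wirtinger k) * conjCoord k := by simp only [Matrix.mul_assoc]
        _ = 1 := by rw [← h1, Matrix.mul_one, wirtinger_mul_conjCoord]
    refine Matrix.map_injective Complex.ofReal_injective ?_
    change (C * F).map Complex.ofReal = (1 : Matrix _ _ ℝ).map Complex.ofReal
    rw [h3, Matrix.map_one _ Complex.ofReal_zero Complex.ofReal_one]
  · intro h2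
    rw [hCF, h2, Matrix.map_one _ Complex.ofReal_zero Complex.ofReal_one, Matrix.mul_one,
      conjCoord_mul_wirtinger] at h1
    exact (Matrix.inv_eq_left_inv h1).symm

end Covariance

/-! ### Necessity of the commutation relations -/

section Necessity

variable {H : Type*} [NormedAddCommGroup H] [InnerProductSpace ℂ H]
  {k : ℕ} {Θ : Set (Fin k → ℂ)} {ψ : (Fin k → ℂ) → H} {θ₀ : Fin k → ℂ}
  {Ω : Type*} [MeasurableSpace Ω] {M : POVM Ω H} {t : Ω → (Fin k → ℂ)}

theorem memLp_two_of_lintegral_le {P : Measure Ω} {f : Ω → ℂ} (hf : Measurable f) {C : ℝ≥0}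
    (h : ∫⁻ ω, ‖f ω‖ₑ ^ 2 ∂P ≤ C) : MemLp f 2 P ∧ ∫ ω, ‖f ω‖ ^ 2 ∂P ≤ C := by
  constructor
  · refine ⟨hf.aestronglyMeasurable, ?_⟩
    rw [eLpNorm_lt_top_iff_lintegral_rpow_enorm_lt_top two_ne_zero ENNReal.ofNat_ne_top]
    simpa using h.trans_lt ENNReal.coe_lt_top
  · have h1 : ∫ ω, ‖f ω‖ ^ 2 ∂P = (∫⁻ ω, ‖f ω‖ₑ ^ 2 ∂P).toReal := by
      rw [integral_eq_lintegral_of_nonneg_ae (ae_of_all _ fun ω => by positivity)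
        (hf.norm.pow_const 2).aestronglyMeasurable]
      simp only [ENNReal.ofReal_pow (norm_nonneg _), ofReal_norm]
    rw [h1]
    exact ENNReal.toReal_le_coe_of_le_coe h

theorem integral_coordError_sq_le {P : Measure Ω} [IsProbabilityMeasure P] {C : ℝ}
    (h : ∀ i, MemLp (fun ω => t ω i) 2 P ∧ ∫ ω, ‖t ω i‖ ^ 2 ∂P ≤ C) (θ₀ : Fin k → ℂ)
    (x : Fin k ⊕ Fin k) : ∫ ω, coordError t θ₀ x ω ^ 2 ∂P ≤ 2 * C + 2 * coord x θ₀ ^ 2 := by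
  obtain ⟨i, hi⟩ : ∃ i, ∀ z : Fin k → ℂ, coord x z ^ 2 ≤ ‖z i‖ ^ 2 := by
    rcases x with i | i
    · exact ⟨i, fun z => by
        rw [← sq_abs]; exact pow_le_pow_left₀ (abs_nonneg _) (Complex.abs_re_le_norm _) 2⟩
    · exact ⟨i, fun z => by
        rw [← sq_abs]; exact pow_le_pow_left₀ (abs_nonneg _) (Complex.abs_im_le_norm _) 2⟩
  have hint := (h i).1.integrable_norm_pow two_ne_zero
  calc _ ≤ ∫ ω, (2 * ‖t ω i‖ ^ 2 + 2 * coord x θ₀ ^ 2) ∂P := by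
        refine integral_mono_of_nonneg (ae_of_all _ fun ω => by positivity)
          ((hint.const_mul 2).add (integrable_const _)) (ae_of_all _ fun ω => ?_)
        simp only [coordError]
        nlinarith [hi (t ω), sq_nonneg (coord x (t ω) + coord x θ₀)]
    _ ≤ _ := by
        rw [integral_add (hint.const_mul 2) (integrable_const _), integral_const_mul,
          integral_const, probReal_univ, one_smul]
        linarith [(h i).2]

theorem hasDerivAt_coord {g : ℝ → Fin k → ℂ} {g' : Fin k → ℂ} {r : ℝ}
    (h : ∀ i, HasDerivAt (fun s => g s i) (g' i) r) (x : Fin k ⊕ Fin k) :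
    HasDerivAt (fun s => coord x (g s)) (coord x g') r := by
  rcases x with i | i
  · exact Complex.reCLM.hasFDerivAt.comp_hasDerivAt r (h i)
  · exact Complex.imCLM.hasFDerivAt.comp_hasDerivAt r (h i)

/-- The vectors `∫ (t_x - θ_x) dM ψ` of a locally unbiased estimator are dual to the horizontal
tangent vectors. -/
theorem IsLocallyUnbiased.re_inner_integralVec [CompleteSpace H] (hΘ : IsOpen Θ)
    (hψ : ∀ θ ∈ Θ, ‖ψ θ‖ = 1) (hθ₀ : θ₀ ∈ Θ) (hdiff : HasPartials ψ θ₀)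
    (ht : IsLocallyUnbiased ψ θ₀ M t) (x y : Fin k ⊕ Fin k) :
    (⟪horizontal ψ θ₀ y,
      M.integralVec (measurable_coordError ht.measurable θ₀ x) (ψ θ₀)⟫_ℂ).re =
      if x = y then 1 else 0 := by
  have hm (i : Fin k) : Measurable fun ω => t ω i := (measurable_pi_apply i).comp ht.measurable
  obtain ⟨C, hC⟩ := ht.second_moment
  have hC' : ∀ᶠ θ in 𝓝 θ₀, ‖ψ θ‖ = 1 ∧ ∀ i, MemLp (fun ω => t ω i) 2 (M.law (ψ θ)) ∧
      ∫ ω, ‖t ω i‖ ^ 2 ∂(M.law (ψ θ)) ≤ C := by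
    filter_upwards [hC, hΘ.mem_nhds hθ₀] with θ h hθ
    exact ⟨hψ θ hθ, fun i => memLp_two_of_lintegral_le (hm i) (h i)⟩
  have hline : Tendsto (fun r : ℝ => θ₀ + r • coordDir y) (𝓝 0) (𝓝 θ₀) := by
    have : Continuous fun r : ℝ => θ₀ + r • (coordDir y : Fin k → ℂ) := by fun_prop
    simpa using this.tendsto 0
  have hev := hline.eventually hC'
  obtain ⟨hv, hmem⟩ := hC'.self_of_nhds
  have := M.isProbabilityMeasure_law hv
  have hs := memLp_coordError (fun i => (hmem i).1) θ₀ x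
  -- The derivative of the mean error is computed twice: from the measurement here, and from the
  -- Jacobian condition below.
  have hd1 := M.hasDerivAt_integral_law (measurable_coordError ht.measurable θ₀ x)
    (hasDerivAt_line hdiff y) (hev.mono fun r hr => by
      have := M.isProbabilityMeasure_law hr.1
      exact ⟨memLp_coordError (fun i => (hr.2 i).1) θ₀ x, integral_coordError_sq_le hr.2 θ₀ x⟩)
  have hd2 : HasDerivAt (fun r : ℝ => ∫ ω, coordError t θ₀ x ω
      ∂(M.law (ψ (θ₀ + r • coordDir y)))) (if x = y then 1 else 0) 0 := by
    have h1 := (hasDerivAt_coord (g' := coordDir y) (fun i => by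
      have h := hasDerivAt_line (ht.hasPartials i) y
      rwa [jacobianHat_eq_one_iff.1 ht.jacobian_eq y i] at h) x).sub_const (coord x θ₀)
    rw [coord_coordDir] at h1
    refine h1.congr_of_eventuallyEq (hev.mono fun r hr => ?_)
    have := M.isProbabilityMeasure_law hr.1
    exact integral_coordError (fun i => (hr.2 i).1) θ₀ x
  simp only [zero_smul, add_zero] at hd1
  -- The error has mean zero, so its vector is orthogonal to ψ(θ₀) and ∂ψ may be replaced by its
  -- horizontal part.
  have h0 : ⟪ψ θ₀, M.integralVec (measurable_coordError ht.measurable θ₀ x) (ψ θ₀)⟫_ℂ = 0 := by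
    rw [M.inner_integralVec _ hs, integral_coordError (fun i => (hmem i).1), ht.mean_eq, sub_self,
      Complex.ofReal_zero]
  rw [inner_horizontal_left h0, show (2 : ℂ) = ((2 : ℝ) : ℂ) by norm_num, Complex.re_ofReal_mul]
  exact hd1.unique hd2

theorem im_inner_horizontal_eq_zero [CompleteSpace H] (hΘ : IsOpen Θ)
    (hψ : ∀ θ ∈ Θ, ‖ψ θ‖ = 1) (hθ₀ : θ₀ ∈ Θ) (hdiff : HasPartials ψ θ₀)
    (ht : IsLocallyUnbiased ψ θ₀ M t)
    (hcov : realCov (M.law (ψ θ₀)) t θ₀ * realFisher ψ θ₀ = 1) (x y : Fin k ⊕ Fin k) :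
    (⟪horizontal ψ θ₀ x, horizontal ψ θ₀ y⟫_ℂ).im = 0 := by
  set l := horizontal ψ θ₀ with hl
  set C := realCov (M.law (ψ θ₀)) t θ₀ with hCdef
  set F := realFisher ψ θ₀ with hF
  have hm (i : Fin k) : Measurable fun ω => t ω i := (measurable_pi_apply i).comp ht.measurable
  obtain ⟨K, hK⟩ := ht.second_moment
  have hmem (i : Fin k) : MemLp (fun ω => t ω i) 2 (M.law (ψ θ₀)) :=
    (memLp_two_of_lintegral_le (hm i) (hK.self_of_nhds i)).1
  have hs := memLp_coordError hmem θ₀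
  set Y : Fin k ⊕ Fin k → H := fun x =>
    M.integralVec (measurable_coordError ht.measurable θ₀ x) (ψ θ₀) with hY
  have hdual (x y) : (⟪l y, Y x⟫_ℂ).re = if x = y then 1 else 0 :=
    ht.re_inner_integralVec hΘ hψ hθ₀ hdiff x y
  have hCxx (x) : C x x = ∫ ω, coordError t θ₀ x ω ^ 2 ∂(M.law (ψ θ₀)) := by
    simp only [hCdef, realCov, Matrix.of_apply, sq]
  set m : Fin k ⊕ Fin k → H := fun x => ∑ z, (C x z : ℂ) • l z with hmdef
  have hlm (x y) : (⟪l y, m x⟫_ℂ).re = if x = y then 1 else 0 := by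
    have h := congrFun (congrFun hcov x) y
    rw [Matrix.mul_apply, Matrix.one_apply] at h
    rw [← h, hmdef, inner_sum, Complex.re_sum]
    refine Finset.sum_congr rfl fun z _ => ?_
    rw [inner_smul_right, Complex.re_ofReal_mul, ← inner_conj_symm, Complex.conj_re]
    rfl
  have hmw (w : H) (x) : (⟪m x, w⟫_ℂ).re = ∑ z, C x z * (⟪l z, w⟫_ℂ).re := by
    rw [hmdef, sum_inner, Complex.re_sum]
    refine Finset.sum_congr rfl fun z _ => ?_
    rw [inner_smul_left, Complex.conj_ofReal, Complex.re_ofReal_mul]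
  have hmm (x) : ‖m x‖ ^ 2 = C x x := by
    have h : ‖m x‖ ^ 2 = (⟪m x, m x⟫_ℂ).re := by rw [inner_self_eq_norm_sq_to_K]; norm_cast
    rw [h, hmw]
    simp [hlm]
  -- Equality case of the bound: ‖m − Y‖² = ‖m‖² − 2 Re⟨m, Y⟩ + ‖Y‖² ≤ C_xx − 2C_xx + C_xx.
  have hYm (x) : Y x = m x := by
    have h1 : ‖Y x - m x‖ ^ 2 ≤ 0 := by
      have e1 : (⟪m x, Y x⟫_ℂ).re = C x x := by simp [hmw, hdual]
      have e2 := M.norm_integralVec_sq_le (measurable_coordError ht.measurable θ₀ x) (hs x)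
      rw [← hCxx] at e2
      have e3 := norm_sub_sq (𝕜 := ℂ) (m x) (Y x)
      rw [norm_sub_rev, e3, RCLike.re_eq_complex_re, e1, hmm]
      change ‖Y x‖ ^ 2 ≤ _ at e2
      linarith
    have h2 : ‖Y x - m x‖ = 0 := by nlinarith [norm_nonneg (Y x - m x)]
    exact sub_eq_zero.1 (norm_eq_zero.1 h2)
  -- The joint bound for the errors x and y leaves −2 Im⟨m_x, m_y⟩ ≤ 0.
  have him (x y) : 0 ≤ (⟪m x, m y⟫_ℂ).im := by
    have e1 := M.norm_integralVec_add_sq_le (measurable_coordError ht.measurable θ₀ x)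
      (measurable_coordError ht.measurable θ₀ y) (hs x) (hs y)
    rw [← hCxx, ← hCxx] at e1
    change ‖Y x + Complex.I • Y y‖ ^ 2 ≤ _ at e1
    rw [hYm, hYm, norm_add_sq (𝕜 := ℂ), norm_smul, Complex.norm_I, one_mul, hmm, hmm,
      inner_smul_right, RCLike.re_eq_complex_re, Complex.I_mul_re] at e1
    linarith
  have him0 (x y) : (⟪m x, m y⟫_ℂ).im = 0 := by
    have h := him y x
    rw [← inner_conj_symm, Complex.conj_im] at h
    linarith [him x y]
  have hcov' : F * C = 1 := mul_eq_one_comm.1 hcov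
  have hlF (z) : l z = ∑ x, (F z x : ℂ) • m x := by
    simp only [hmdef, Finset.smul_sum, smul_smul]
    rw [Finset.sum_comm]
    simp only [← Finset.sum_smul, ← Complex.ofReal_mul, ← Complex.ofReal_sum, ← Matrix.mul_apply,
      hcov', Matrix.one_apply]
    simp
  rw [hlF x, hlF y, sum_inner, Complex.im_sum]
  refine Finset.sum_eq_zero fun z _ => ?_
  rw [inner_sum, Complex.im_sum]
  refine Finset.sum_eq_zero fun w _ => ?_
  rw [inner_smul_left, inner_smul_right, Complex.conj_ofReal, Complex.im_ofReal_mul,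
    Complex.im_ofReal_mul, him0, mul_zero, mul_zero]

end Necessity

/-! ### Sufficiency of the commutation relations -/

section Sufficiency

variable {H : Type*} [NormedAddCommGroup H] [InnerProductSpace ℂ H]
  {k : ℕ} {Θ : Set (Fin k → ℂ)} {ψ : (Fin k → ℂ) → H} {θ₀ : Fin k → ℂ}

theorem posSemidef_realFisher : (realFisher ψ θ₀).PosSemidef := by
  refine Matrix.PosSemidef.of_dotProduct_mulVec_nonneg ?_ fun z => ?_
  · ext x y
    simp only [Matrix.conjTranspose_apply, realFisher, Matrix.of_apply, star_trivial]
    rw [← inner_conj_symm, Complex.conj_re]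
  · have h : star z ⬝ᵥ (realFisher ψ θ₀).mulVec z =
        (⟪∑ x, (z x : ℂ) • horizontal ψ θ₀ x, ∑ y, (z y : ℂ) • horizontal ψ θ₀ y⟫_ℂ).re := by
      rw [sum_inner, Complex.re_sum]
      refine Finset.sum_congr rfl fun x _ => ?_
      rw [inner_smul_left, Complex.conj_ofReal, Complex.re_ofReal_mul, inner_sum, Complex.re_sum,
        Matrix.mulVec_eq_sum, Finset.sum_apply]
      refine congrArg (z x * ·) (Finset.sum_congr rfl fun y _ => ?_)
      rw [inner_smul_right, Complex.re_ofReal_mul]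
      exact mul_comm _ _
    rw [h]
    exact inner_self_nonneg (𝕜 := ℂ)

theorem isUnit_realFisher {S : Matrix (Fin k ⊕ Fin k) (Fin k ⊕ Fin k) ℂ} (hS : IsUnit S)
    (h : S = (wirtinger k).conjTranspose * (realFisher ψ θ₀).map Complex.ofReal * wirtinger k) :
    IsUnit (realFisher ψ θ₀) := by
  rw [Matrix.isUnit_iff_isUnit_det, isUnit_iff_ne_zero] at hS ⊢
  intro h0
  apply hS
  have h1 : ((realFisher ψ θ₀).map Complex.ofReal).det = 0 := by
    have := (Complex.ofRealHom.map_det (realFisher ψ θ₀)).symm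
    rw [h0, map_zero] at this
    exact this
  rw [h, Matrix.det_mul, Matrix.det_mul, h1, mul_zero, zero_mul]

open scoped MatrixOrder in
/-- A positive definite real matrix `F` becomes the identity in suitable coordinates. -/
theorem exists_normalizing_matrix {n : Type*} [Fintype n] [DecidableEq n] {F : Matrix n n ℝ}
    (hF : F.PosSemidef) (hu : IsUnit F) :
    ∃ R : Matrix n n ℝ, R.transpose * F * R = 1 ∧ R * R.transpose * F = 1 := by
  -- F = BᵀB, and R = B⁻¹.
  obtain ⟨B, rfl⟩ := CStarAlgebra.nonneg_iff_eq_star_mul_self.mp hF.nonneg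
  rw [Matrix.star_eq_conjTranspose, Matrix.conjTranspose_eq_transpose_of_trivial] at hu ⊢
  have hB : IsUnit B.det := by
    rw [Matrix.isUnit_iff_isUnit_det, Matrix.det_mul] at hu
    exact isUnit_of_mul_isUnit_right hu
  have h1 : B * B⁻¹ = 1 := Matrix.mul_nonsing_inv B hB
  have h2 : B⁻¹ * B = 1 := Matrix.nonsing_inv_mul B hB
  have h3 : (B⁻¹).transpose * B.transpose = 1 := by
    rw [← Matrix.transpose_mul, h1, Matrix.transpose_one]
  refine ⟨B⁻¹, ?_, ?_⟩
  · calc _ = ((B⁻¹).transpose * B.transpose) * (B * B⁻¹) := by simp only [Matrix.mul_assoc]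
      _ = 1 := by rw [h1, h3, Matrix.one_mul]
  · calc _ = B⁻¹ * ((B⁻¹).transpose * B.transpose) * B := by simp only [Matrix.mul_assoc]
      _ = 1 := by rw [h3, Matrix.mul_one, h2]

/-- The combinations of the horizontal tangent vectors with the columns of `R`. -/
def frame (ψ : (Fin k → ℂ) → H) (θ₀ : Fin k → ℂ)
    (R : Matrix (Fin k ⊕ Fin k) (Fin k ⊕ Fin k) ℝ) (j : Fin k ⊕ Fin k) : H :=
  ∑ x, (R x j : ℂ) • horizontal ψ θ₀ x

theorem inner_frame (hv : ‖ψ θ₀‖ = 1) (R : Matrix (Fin k ⊕ Fin k) (Fin k ⊕ Fin k) ℝ)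
    (j : Fin k ⊕ Fin k) : ⟪ψ θ₀, frame ψ θ₀ R j⟫_ℂ = 0 := by
  rw [frame, inner_sum]
  refine Finset.sum_eq_zero fun x _ => ?_
  rw [inner_smul_right, inner_horizontal hv, mul_zero]

/-- Only here does sufficiency use that the Gram matrix is real: normalizing F then gives
orthonormality over ℂ, not merely for the real part of the inner product. -/
theorem orthonormal_frame (him : ∀ x y, (⟪horizontal ψ θ₀ x, horizontal ψ θ₀ y⟫_ℂ).im = 0)
    {R : Matrix (Fin k ⊕ Fin k) (Fin k ⊕ Fin k) ℝ}
    (hR : R.transpose * realFisher ψ θ₀ * R = 1) : Orthonormal ℂ (frame ψ θ₀ R) := by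
  rw [orthonormal_iff_ite]
  intro i j
  have hG (x y) : ⟪horizontal ψ θ₀ x, horizontal ψ θ₀ y⟫_ℂ = (realFisher ψ θ₀ x y : ℂ) :=
    Complex.ext (by simp [realFisher]) (by simp [him])
  have h := congrFun (congrFun hR i) j
  rw [Matrix.one_apply, Matrix.mul_assoc] at h
  have h' : ⟪frame ψ θ₀ R i, frame ψ θ₀ R j⟫_ℂ =
      (((R.transpose * (realFisher ψ θ₀ * R)) i j : ℝ) : ℂ) := by
    rw [frame, sum_inner, Matrix.mul_apply, Complex.ofReal_sum]
    refine Finset.sum_congr rfl fun x _ => ?_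
    rw [inner_smul_left, Complex.conj_ofReal, Matrix.transpose_apply, Complex.ofReal_mul, frame,
      inner_sum, Matrix.mul_apply, Complex.ofReal_sum]
    refine congrArg ((R x i : ℂ) * ·) (Finset.sum_congr rfl fun y _ => ?_)
    rw [inner_smul_right, hG, Complex.ofReal_mul, mul_comm]
  rw [h', h]
  split_ifs <;> simp

theorem lintegral_enorm_sq_le_of_finite {Ω : Type*} [Finite Ω] [MeasurableSpace Ω]
    (t : Ω → Fin k → ℂ) : ∃ C : ℝ≥0, ∀ (P : Measure Ω) [IsProbabilityMeasure P] (i : Fin k),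
      ∫⁻ ω, ‖t ω i‖ₑ ^ 2 ∂P ≤ C := by
  obtain ⟨C, hC⟩ := (Set.finite_range fun p : Ω × Fin k => ‖t p.1 p.2‖₊ ^ 2).bddAbove
  refine ⟨C, fun P _ i => ?_⟩
  calc _ ≤ ∫⁻ _, (C : ℝ≥0∞) ∂P := by
        refine lintegral_mono fun ω => ?_
        have h := hC ⟨(ω, i), rfl⟩
        have h' : ((‖t ω i‖₊ ^ 2 : ℝ≥0) : ℝ≥0∞) ≤ C := ENNReal.coe_le_coe.2 h
        simpa [enorm_eq_nnnorm] using h'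
    _ = C := by simp

/-- If the horizontal tangent vectors have a real Gram matrix, a measurement with finitely many
outcomes attains the bound. -/
theorem boundAttainable_of_im_eq_zero [CompleteSpace H] (hΘ : IsOpen Θ)
    (hψ : ∀ θ ∈ Θ, ‖ψ θ‖ = 1) (hθ₀ : θ₀ ∈ Θ) (hdiff : HasPartials ψ θ₀)
    {L : Fin k ⊕ Fin k → H →L[ℂ] H} (hL : IsComplexSLD ψ θ₀ L)
    (hJ : IsUnit (sqfim (ψ θ₀) L))
    (him : ∀ x y, (⟪horizontal ψ θ₀ x, horizontal ψ θ₀ y⟫_ℂ).im = 0) :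
    BoundAttainable ψ θ₀ L := by
  have hS := hL.sqfim_eq hΘ hψ hθ₀ hdiff
  obtain ⟨R, hR1, hR2⟩ := exists_normalizing_matrix (posSemidef_realFisher (ψ := ψ) (θ₀ := θ₀))
    (isUnit_realFisher hJ hS)
  have hv := hψ θ₀ hθ₀
  have hvv := inner_self_of_norm_one hv
  have hve := inner_frame hv R
  set e := frame ψ θ₀ R with he
  have hpos := parityEffect_isPositive hv hve (orthonormal_frame him hR1)
  let _ : MeasurableSpace (Option ((Fin k ⊕ Fin k) × Bool)) := ⊤
  have : DiscreteMeasurableSpace (Option ((Fin k ⊕ Fin k) × Bool)) := ⟨fun _ => trivial⟩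
  set M := POVM.ofFintype (parityEffect (ψ θ₀) e) hpos (sum_parityEffect _ _) with hM
  -- The error in coordinate x is the parity statistic of row x of R.
  set t : Option ((Fin k ⊕ Fin k) × Bool) → Fin k → ℂ := fun ω i => θ₀ i +
    ⟨parityStat (R (Sum.inl i)) ω, parityStat (R (Sum.inr i)) ω⟩ with ht
  have hterr (x) (ω) : coordError t θ₀ x ω = parityStat (R x) ω := by
    rcases x with x | x <;> simp [coordError, coord, ht]
  have hmem (P : Measure (Option ((Fin k ⊕ Fin k) × Bool))) [IsFiniteMeasure P] (i : Fin k) :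
      MemLp (fun ω => t ω i) 2 P := .of_discrete
  obtain ⟨C, hC⟩ := lintegral_enorm_sq_le_of_finite t
  have hprob {θ} (hθ : θ ∈ Θ) : IsProbabilityMeasure (M.law (ψ θ)) :=
    M.isProbabilityMeasure_law (hψ θ hθ)
  -- These are m_x = ∑ (RRᵀ)_xz l_z with RRᵀ = F⁻¹, the vectors dual to the l_x.
  set m : Fin k ⊕ Fin k → H := fun x => ∑ j, (R x j : ℂ) • e j with hm
  have hmean {θ} (hθ : θ ∈ Θ) (x) : coord x (mean (M.law (ψ θ)) t) =
      coord x θ₀ + 2 * (⟪ψ θ, m x⟫_ℂ * ⟪ψ θ₀, ψ θ⟫_ℂ).re := by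
    have := hprob hθ
    have h1 := integral_coordError (hmem (M.law (ψ θ))) θ₀ x
    simp only [hterr] at h1
    rw [hM, POVM.integral_law_ofFintype, sum_parityEffect_mul] at h1
    rw [hM]
    linarith
  have hvm (x) : ⟪ψ θ₀, m x⟫_ℂ = 0 := by
    rw [hm, inner_sum]
    exact Finset.sum_eq_zero fun j _ => by rw [inner_smul_right, hve, mul_zero]
  have hdual (x y) : 2 * (⟪lineDeriv ℝ ψ θ₀ (coordDir y), m x⟫_ℂ).re =
      if x = y then 1 else 0 := by
    have h1 := inner_horizontal_left (hvm x) y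
    have h2 : 2 * (⟪lineDeriv ℝ ψ θ₀ (coordDir y), m x⟫_ℂ).re =
        (⟪horizontal ψ θ₀ y, m x⟫_ℂ).re := by
      rw [h1, show (2 : ℂ) = ((2 : ℝ) : ℂ) by norm_num, Complex.re_ofReal_mul]
    rw [h2, ← Matrix.one_apply, ← hR2, Matrix.mul_assoc]
    simp only [hm, he, frame, inner_sum, inner_smul_right, Complex.re_sum, Complex.re_ofReal_mul,
      Matrix.mul_apply, Matrix.transpose_apply]
    refine Finset.sum_congr rfl fun j _ => ?_
    congr 1
    refine Finset.sum_congr rfl fun z _ => ?_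
    congr 1
    rw [← inner_conj_symm, Complex.conj_re]
    rfl
  have hmean0 : mean (M.law (ψ θ₀)) t = θ₀ := coord_ext fun x => by
    rw [hmean hθ₀, hvm, zero_mul, Complex.zero_re, mul_zero, add_zero]
  have hderiv (y) (i : Fin k) : HasLineDerivAt ℝ (fun θ => mean (M.law (ψ θ)) t i)
      (coordDir y i) θ₀ (coordDir y) := by
    have hx (x) : HasDerivAt (fun r : ℝ => coord x (mean (M.law (ψ (θ₀ + r • coordDir y))) t))
        (coord x (coordDir y)) 0 := by
      have hγ := hasDerivAt_line hdiff y
      have h1 : HasDerivAt (fun r : ℝ => ⟪ψ (θ₀ + r • coordDir y), m x⟫_ℂ *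
          ⟪ψ θ₀, ψ (θ₀ + r • coordDir y)⟫_ℂ) _ 0 :=
        (hγ.inner ℂ (hasDerivAt_const (0 : ℝ) (m x))).mul
          ((hasDerivAt_const (0 : ℝ) (ψ θ₀)).inner ℂ hγ)
      have h2 := (((Complex.reCLM.hasFDerivAt.comp_hasDerivAt (0 : ℝ) h1).const_mul
        2).const_add (coord x θ₀))
      -- In the product rule only the derivative of the first factor survives, since ⟨ψ(θ₀), m_x⟩ =
      -- 0 and ⟨ψ(θ₀), ψ(θ₀)⟩ = 1.
      have h3 : coord x (coordDir y) = 2 * Complex.reCLM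
          ((⟪ψ (θ₀ + (0 : ℝ) • coordDir y), 0⟫_ℂ +
            ⟪lineDeriv ℝ ψ θ₀ (coordDir y), m x⟫_ℂ) * ⟪ψ θ₀, ψ (θ₀ + (0 : ℝ) • coordDir y)⟫_ℂ +
          ⟪ψ (θ₀ + (0 : ℝ) • coordDir y), m x⟫_ℂ * (⟪ψ θ₀, lineDeriv ℝ ψ θ₀ (coordDir y)⟫_ℂ +
            ⟪(0 : H), ψ (θ₀ + (0 : ℝ) • coordDir y)⟫_ℂ)) := by
        rw [zero_smul, add_zero, hvm, hvv, zero_mul, add_zero, mul_one, inner_zero_right, zero_add,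
          Complex.reCLM_apply, hdual, coord_coordDir]
      rw [h3]
      refine h2.congr_of_eventuallyEq ?_
      filter_upwards [eventually_line hΘ hθ₀ (coordDir y)] with r hr
      exact hmean hr x
    have h4 := (((hx (Sum.inl i)).ofReal_comp).add
      (((hx (Sum.inr i)).ofReal_comp).mul_const Complex.I))
    have h5 (z : Fin k → ℂ) : (coord (Sum.inl i) z : ℂ) + (coord (Sum.inr i) z : ℂ) * Complex.I =
        z i := Complex.re_add_im (z i)
    rw [h5] at h4
    refine HasDerivAt.congr_of_eventuallyEq h4 (Eventually.of_forall fun r => ?_)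
    exact (h5 (mean (M.law (ψ (θ₀ + r • coordDir y))) t)).symm
  refine ⟨_, ⊤, M, t, ⟨measurable_from_top, ⟨C, ?_⟩, hmean0, fun i => ?_, ?_⟩, ?_⟩
  · filter_upwards [hΘ.mem_nhds hθ₀] with θ hθ i
    have := hprob hθ
    exact hC _ i
  · exact hasPartials_iff.2 fun y => (hderiv y i).lineDifferentiableAt
  · exact jacobianHat_eq_one_iff.2 fun y i => (hderiv y i).lineDeriv
  · have := hprob hθ₀
    rw [covHat_eq (hmem _) hmean0, conj_mul_eq_inv_iff hJ hS, ← hR2]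
    congr 1
    ext x y
    simp only [realCov, Matrix.of_apply, hterr]
    rw [hM, POVM.integral_law_ofFintype, sum_parityEffect_mul_mul hv hve, Matrix.mul_apply]
    rfl

end Sufficiency
end ComplexQCRB

end

theorem theorem7 {H : Type*} [NormedAddCommGroup H] [InnerProductSpace ℂ H] [CompleteSpace H]
    {k : ℕ} (Θ : Set (Fin k → ℂ)) (hΘ : IsOpen Θ) (ψ : (Fin k → ℂ) → H)
    (hψ : ∀ θ ∈ Θ, ‖ψ θ‖ = 1) (θ₀ : Fin k → ℂ) (hθ₀ : θ₀ ∈ Θ)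
    (hdiff : ComplexQCRB.HasPartials ψ θ₀)
    (L : Fin k ⊕ Fin k → H →L[ℂ] H) (hL : ComplexQCRB.IsComplexSLD ψ θ₀ L)
    (hJ : IsUnit (ComplexQCRB.sqfim (ψ θ₀) L)) :
    ComplexQCRB.BoundAttainable ψ θ₀ L ↔
      ∀ a b : Fin k ⊕ Fin k, ⟪ψ θ₀, (L a * L b - L b * L a) (ψ θ₀)⟫_ℂ = 0 := by
  rw [hL.commutator_eq_zero_iff hΘ hψ hθ₀ hdiff]
  refine ⟨?_, ComplexQCRB.boundAttainable_of_im_eq_zero hΘ hψ hθ₀ hdiff hL hJ⟩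
  rintro ⟨Ω, _, M, t, ht, hcov⟩
  have hm (i : Fin k) : Measurable fun ω => t ω i := (measurable_pi_apply i).comp ht.measurable
  obtain ⟨K, hK⟩ := ht.second_moment
  have := M.isProbabilityMeasure_law (hψ θ₀ hθ₀)
  rw [ComplexQCRB.covHat_eq
    (fun i => (ComplexQCRB.memLp_two_of_lintegral_le (hm i) (hK.self_of_nhds i)).1) ht.mean_eq,
    ComplexQCRB.conj_mul_eq_inv_iff hJ (hL.sqfim_eq hΘ hψ hθ₀ hdiff)] at hcov
  exact ComplexQCRB.im_inner_horizontal_eq_zero hΘ hψ hθ₀ hdiff ht hcov
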